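/- **Notation.** Fix $d\ge 0$. Write $z=(x,\omega)\in\mathbb{R}^{2d}$, $(\pi(z)\psi)(t)=e^{2\pi i\omega\cdot t}\psi(t-x)$ on $L^2(\mathbb{R}^d)$, $W(z)=e^{-\pi i x\cdot\omega}\pi(z)$, $(P\psi)(t)=\psi(-t)$, $\alpha_z(A)=\pi(z)A\pi(z)^*$, $\check A=PAP$, $\xi\otimes\eta(\zeta)=\langle\zeta,\eta\rangle\xi$ (inner products are linear in the first variable), and let $\mathcal{T}^1$ be the trace class operators on $L^2(\mathbb{R}^d)$. For $f\in L^1(\mathbb{R}^{2d})$ and $S,T\in\mathcal{T}^1$ let $f\ast S=\int f(y)\,\alpha_y(S)\,dy$ (weak integral) and let $S\ast T$ be the function $S\ast T(z)=\mathrm{tr}(S\,\alpha_z(\check T))$; for functions, $\ast$ is the usual convolution on $\mathbb{R}^{2d}$. Let $$\mathcal{F}f(z)=\int f(z')e^{-2\pi i[z,z']}\,dz',\qquad [(x_1,\omega_1),(x_2,\omega_2)]=\omega_1\cdot x_2-\omega_2\cdot x_1,$$ $$\mathcal{F}_W(S)(z)=e^{-\pi i x\cdot\omega}\,\mathrm{tr}(\pi(-z)S)=\mathrm{tr}(W(z)^*S).$$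 For $\sigma,S\in\mathcal{T}^1$: * the (Klauder–Skagerstam) *generalized Husimi representation* $S_\sigma$ of $S$ is the integrable function with $\mathcal{F}(S_\sigma)(z)=\mathrm{tr}(W(z)\sigma)\,\mathcal{F}_W(S)(z)$ for all $z$; * a *generalized Glauber–Sudarshan representation* $S_{-\sigma}$ of $S$ is an integrable function with $\mathcal{F}(S_{-\sigma})(z)\cdot\mathrm{tr}(W(z)^*\sigma^*)=\mathcal{F}_W(S)(z)$ for all $z$. Let $\phi(x)=2^{d/4}e^{-\pi x\cdot x}$. The *Husimi representation* of $S$ is $S_H(z)=\langle S\pi(z)\phi,\pi(z)\phi\rangle$, and a function $a$ is a *Glauber–Sudarshan representation* $S_{G-S}$ of $S$ if $S\psi=\int a(z)\langle\psi,\pi(z)\phi\rangle\,\pi(z)\phi\,dz$, as a convergent vector-valued integral, for all $\psi\in L^2(\mathbb{R}^d)$. Equalities of $S_\sigma$ and $S_{-\sigma}$ with other functions are equalities almost everywhere. **Theorem 3.1.** Let $\sigma,S\in\mathcal{T}^1$. 1. $S\ast\check\sigma\in L^1(\mathbb{R}^{2d})$, the generalized Husimi representation of $S$ exists and is unique, $S_\sigma=S\ast\check\sigma$,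 and $S\ast\check\sigma(z)=\mathrm{tr}(S\,\alpha_z(\sigma))$ for all $z$. 2. If $S=f\ast\sigma^*$ with $f\in L^1(\mathbb{R}^{2d})$, then $f$ is a generalized Glauber–Sudarshan representation of $S$, that is, $S_{-\sigma}=f$. If moreover $\{z:\mathcal{F}_W(\sigma)(z)\neq0\}$ is dense (in particular if $\mathcal{F}_W(\sigma)$ has no zeros), then it is the only one. 3. If $S$ has a generalized Glauber–Sudarshan representation $S_{-\sigma}\in L^1(\mathbb{R}^{2d})$, then $S=S_{-\sigma}\ast\sigma^*$ and $$S_\sigma=(S_{-\sigma}\ast\sigma^*)\ast\check\sigma=S_{-\sigma}\ast(\sigma^*\ast\check\sigma)=S_{-\sigma}\ast\mathrm{tr}(\sigma^*\alpha_z\sigma),$$ where the second and third equalities hold at every point. Furthermore, let $\sigma=\phi\otimes\phi$. Then $S_\sigma=S_H$, and $S\ast\check\sigma=S_H$ at every point. A function $f\in L^1(\mathbb{R}^{2d})$ is a generalized Glauber–Sudarshan representation of $S$ if and only if it is a Glauber–Sudarshan representation of $S$, and there is at most one such $f$; that is, $S_{-\sigma}=S_{G-S}$. -/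

import Mathlib

open MeasureTheory

namespace PhaseSpace

noncomputable section

/-! ## Configuration space, phase space, and the Hilbert space -/

/-- Configuration space `ℝ^d`, with its Euclidean structure. -/
abbrev Conf (d : ℕ) : Type := EuclideanSpace ℝ (Fin d)

/-- Phase space `ℝ^{2d}`; its points are the pairs `z = (x, ω)`. Its measure `volume` is
Lebesgue measure. -/
abbrev Phase (d : ℕ) : Type := Conf d × Conf d

/-- The Hilbert space `L²(ℝ^d)` of complex-valued functions. -/
abbrev Hilb (d : ℕ) : Type := Lp ℂ 2 (volume : Measure (Conf d))

/-- Bounded operators on `L²(ℝ^d)`. -/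
abbrev Op (d : ℕ) : Type := Hilb d →L[ℂ] Hilb d

/-! ## Trace class operators and the trace -/

section TraceClass

variable {E : Type*} [NormedAddCommGroup E] [InnerProductSpace ℂ E] [CompleteSpace E]

/-- `S` is of trace class: it has a (countable) singular value decomposition
`S = ∑ᵢ sᵢ uᵢ ⊗ vᵢ`, with `u` and `v` orthonormal systems, whose singular values `sᵢ ≥ 0` are
summable. The index set is a set of natural numbers, so that finite decompositions are included. -/
def IsTraceClass (S : E →L[ℂ] E) : Prop :=
  ∃ (ι : Set ℕ) (s : ι → ℝ) (u v : ι → E),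
    Orthonormal ℂ u ∧ Orthonormal ℂ v ∧ (∀ i, 0 ≤ s i) ∧ Summable s ∧
      ∀ ψ, HasSum (fun i => ((s i : ℂ) * inner ℂ (v i) ψ) • u i) (S ψ)

/-- The trace `∑ₑ ⟨e, A e⟩` over an orthonormal basis. (For a trace class operator the sum
converges absolutely and does not depend on the basis.) -/
def tr (A : E →L[ℂ] E) : ℂ :=
  ∑' e : (exists_hilbertBasis ℂ E).choose,
    inner ℂ ((exists_hilbertBasis ℂ E).choose_spec.choose e)
      (A ((exists_hilbertBasis ℂ E).choose_spec.choose e))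

end TraceClass

/-! ## Time-frequency shifts and parity -/

variable {d : ℕ}

/-- Translation `(T_x ψ)(t) = ψ(t - x)`. -/
def translation (x : Conf d) : Hilb d →ₗᵢ[ℂ] Hilb d :=
  Lp.compMeasurePreservingₗᵢ ℂ (fun t => t - x) (measurePreserving_sub_right volume x)

/-- The character `t ↦ e^{2πi ω·t}`. -/
def character (ω t : Conf d) : ℂ := Complex.exp (2 * Real.pi * (inner ℝ ω t : ℝ) * Complex.I)

theorem norm_character (ω t : Conf d) : ‖character ω t‖ = 1 := by
  have h : (2 * Real.pi * (inner ℝ ω t : ℝ) * Complex.I : ℂ)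
      = ((2 * Real.pi * inner ℝ ω t : ℝ) : ℂ) * Complex.I := by push_cast; ring
  rw [character, h, Complex.norm_exp_ofReal_mul_I]

theorem continuous_character_right (ω : Conf d) : Continuous fun t => character ω t := by
  unfold character
  fun_prop

theorem continuous_character_left (t : Conf d) : Continuous fun ω => character ω t := by
  unfold character
  fun_prop

theorem memLp_character_mul (ω : Conf d) (ψ : Hilb d) :
    MemLp (fun t => character ω t * ψ t) 2 volume := by
  have hc := continuous_character_right ω
  have hm : AEStronglyMeasurable (fun t => character ω t * ψ t) volume :=
    hc.aestronglyMeasurable.mul (Lp.aestronglyMeasurable ψ)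
  refine MemLp.of_le (g := fun t => ψ t) (Lp.memLp ψ) hm (Filter.Eventually.of_forall fun t => ?_)
  rw [norm_mul, norm_character, one_mul]

/-- Modulation `(M_ω ψ)(t) = e^{2πi ω·t} ψ(t)`. -/
def modulation (ω : Conf d) : Hilb d →ₗᵢ[ℂ] Hilb d where
  toFun ψ := (memLp_character_mul ω ψ).toLp (fun t => character ω t * ψ t)
  map_add' ψ η := by
    rw [← MemLp.toLp_add]
    refine MemLp.toLp_congr _ _ ?_
    filter_upwards [Lp.coeFn_add ψ η] with t ht
    rw [ht, Pi.add_apply, Pi.add_apply, mul_add]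
  map_smul' c ψ := by
    rw [RingHom.id_apply, ← MemLp.toLp_const_smul]
    refine MemLp.toLp_congr _ _ ?_
    filter_upwards [Lp.coeFn_smul c ψ] with t ht
    rw [ht, Pi.smul_apply, Pi.smul_apply, smul_eq_mul, smul_eq_mul, mul_left_comm]
  norm_map' ψ := by
    have h : ∀ᵐ t, ‖((memLp_character_mul ω ψ).toLp (fun t => character ω t * ψ t)) t‖
        = ‖ψ t‖ := by
      filter_upwards [(memLp_character_mul ω ψ).coeFn_toLp] with t ht
      rw [ht, norm_mul, norm_character, one_mul]
    exact le_antisymm (Lp.norm_le_norm_of_ae_le (h.mono fun _ => le_of_eq))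
      (Lp.norm_le_norm_of_ae_le (h.mono fun _ ht => ht.ge))

/-- The time-frequency shift `π(z) = M_ω T_x`, for `z = (x, ω)`. -/
def tfShift (z : Phase d) : Op d :=
  ((modulation z.2).comp (translation z.1)).toContinuousLinearMap

/-- The parity operator `(P ψ)(t) = ψ(-t)`. -/
def parity : Op d :=
  (Lp.compMeasurePreservingₗᵢ ℂ (fun t : Conf d => -t)
    (Measure.measurePreserving_neg volume)).toContinuousLinearMap

/-- The shift of operators, `α_z(A) = π(z) A π(z)^*`. -/
def shift (z : Phase d) (A : Op d) : Op d :=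
  (tfShift z).comp (A.comp (ContinuousLinearMap.adjoint (tfShift z)))

/-- The involution `Ǎ = P A P` of operators. -/
def check (A : Op d) : Op d := (parity (d := d)).comp (A.comp parity)

/-! ### Time-frequency shifts are unitary and strongly continuous -/

theorem translation_coe (x : Conf d) (ψ : Hilb d) : translation x ψ =ᵐ[volume] fun t => ψ (t - x) :=
  Lp.coeFn_compMeasurePreserving ψ (measurePreserving_sub_right volume x)

theorem modulation_coe (ω : Conf d) (ψ : Hilb d) :
    modulation ω ψ =ᵐ[volume] fun t => character ω t * ψ t :=
  (memLp_character_mul ω ψ).coeFn_toLp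

theorem tfShift_coe (z : Phase d) (ψ : Hilb d) :
    tfShift z ψ =ᵐ[volume] fun t => character z.2 t * ψ (t - z.1) := by
  change modulation z.2 (translation z.1 ψ) =ᵐ[volume] _
  filter_upwards [modulation_coe z.2 (translation z.1 ψ), translation_coe z.1 ψ] with t h1 h2
  rw [h1, h2]

theorem parity_coe (ψ : Hilb d) : parity ψ =ᵐ[volume] fun t => ψ (-t) :=
  Lp.coeFn_compMeasurePreserving ψ (Measure.measurePreserving_neg volume)

theorem norm_tfShift (z : Phase d) (ψ : Hilb d) : ‖tfShift z ψ‖ = ‖ψ‖ :=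
  ((modulation z.2).comp (translation z.1)).norm_map ψ

theorem tfShift_surjective (z : Phase d) : Function.Surjective (tfShift z) := by
  intro ψ
  refine ⟨translation (-z.1) (modulation (-z.2) ψ), ?_⟩
  refine Lp.ext ?_
  have h1 := translation_coe (-z.1) (modulation (-z.2) ψ)
  have h2 := (measurePreserving_sub_right volume z.1).quasiMeasurePreserving.ae_eq_comp h1
  filter_upwards [tfShift_coe z (translation (-z.1) (modulation (-z.2) ψ)), h2,
    modulation_coe (-z.2) ψ] with t ht h2t h3t
  have h2t' : (translation (-z.1) (modulation (-z.2) ψ)) (t - z.1) = (modulation (-z.2) ψ) t := by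
    simpa using h2t
  rw [ht, h2t', h3t, ← mul_assoc]
  have : character z.2 t * character (-z.2) t = 1 := by
    rw [character, character, ← Complex.exp_add]
    simp
  rw [this, one_mul]

theorem tfShift_apply_adjoint (z : Phase d) (ψ : Hilb d) :
    tfShift z (ContinuousLinearMap.adjoint (tfShift z) ψ) = ψ := by
  obtain ⟨χ, rfl⟩ := tfShift_surjective z ψ
  have h : ContinuousLinearMap.adjoint (tfShift z) (tfShift z χ) = χ := by
    refine ext_inner_left ℂ fun η => ?_
    rw [ContinuousLinearMap.adjoint_inner_right]
    exact ((modulation z.2).comp (translation z.1)).inner_map_map η χ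
  rw [h]

theorem norm_adjoint_tfShift (z : Phase d) (ψ : Hilb d) :
    ‖ContinuousLinearMap.adjoint (tfShift z) ψ‖ = ‖ψ‖ := by
  rw [← norm_tfShift z, tfShift_apply_adjoint]

theorem continuous_translation (ψ : Hilb d) : Continuous fun x : Conf d => translation x ψ := by
  have hg : Continuous fun x : Conf d => (⟨fun t => t - x, by fun_prop⟩ : C(Conf d, Conf d)) :=
    ContinuousMap.continuous_of_continuous_uncurry _ (by
      change Continuous fun p : Conf d × Conf d => p.2 - p.1
      fun_prop)
  exact (continuous_const (y := ψ)).compMeasurePreservingLp hg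
    (fun x => measurePreserving_sub_right volume x) (by norm_num)

theorem continuous_modulation (ψ : Hilb d) : Continuous fun ω : Conf d => modulation ω ψ := by
  rw [continuous_iff_continuousAt]
  intro ω₀
  have hin : Continuous fun ω : Conf d => inner ℂ (modulation ω₀ ψ) (modulation ω ψ) := by
    have heq : ∀ ω : Conf d, inner ℂ (modulation ω₀ ψ) (modulation ω ψ)
        = ∫ t, character ω t * (ψ t * (starRingEnd ℂ) (modulation ω₀ ψ t)) := by
      intro ω
      rw [L2.inner_def]
      refine integral_congr_ae ?_
      filter_upwards [modulation_coe ω ψ] with t ht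
      rw [ht, RCLike.inner_apply, mul_assoc]
    simp_rw [heq]
    have hint : Integrable (fun t => ψ t * (starRingEnd ℂ) (modulation ω₀ ψ t)) := by
      simpa [RCLike.inner_apply] using L2.integrable_inner (𝕜 := ℂ) (modulation ω₀ ψ) ψ
    refine continuous_of_dominated (bound := fun t => ‖ψ t * (starRingEnd ℂ) (modulation ω₀ ψ t)‖)
      (fun ω => ?_) (fun ω => ?_) hint.norm ?_
    · exact (continuous_character_right ω).aestronglyMeasurable.mul hint.aestronglyMeasurable
    · filter_upwards with t
      rw [norm_mul, norm_character, one_mul]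
    · filter_upwards with t
      exact (continuous_character_left t).mul continuous_const
  have hnorm : ∀ ω : Conf d, ‖modulation ω ψ - modulation ω₀ ψ‖ ^ 2
      = 2 * ‖ψ‖ ^ 2 - 2 * (inner ℂ (modulation ω₀ ψ) (modulation ω ψ)).re := by
    intro ω
    rw [norm_sub_rev, norm_sub_sq (𝕜 := ℂ), LinearIsometry.norm_map, LinearIsometry.norm_map]
    simp only [RCLike.re_to_complex]
    ring
  have hlim : Filter.Tendsto (fun ω : Conf d => ‖modulation ω ψ - modulation ω₀ ψ‖ ^ 2)
      (nhds ω₀) (nhds 0) := by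
    simp_rw [hnorm]
    have hc : Continuous fun ω : Conf d =>
        2 * ‖ψ‖ ^ 2 - 2 * (inner ℂ (modulation ω₀ ψ) (modulation ω ψ)).re := by fun_prop
    have h0 := hc.tendsto ω₀
    rw [← hnorm ω₀, sub_self, norm_zero] at h0
    simpa using h0
  refine tendsto_iff_norm_sub_tendsto_zero.2 ?_
  have := hlim.sqrt
  simpa using this

theorem continuous_tfShift (ψ : Hilb d) : Continuous fun z : Phase d => tfShift z ψ := by
  rw [continuous_iff_continuousAt]
  intro z₀
  refine tendsto_iff_norm_sub_tendsto_zero.2 ?_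
  have hb : ∀ z : Phase d, ‖tfShift z ψ - tfShift z₀ ψ‖ ≤ ‖translation z.1 ψ - translation z₀.1 ψ‖
      + ‖modulation z.2 (translation z₀.1 ψ) - modulation z₀.2 (translation z₀.1 ψ)‖ := by
    intro z
    have h1 : tfShift z ψ - tfShift z₀ ψ
        = modulation z.2 (translation z.1 ψ - translation z₀.1 ψ)
          + (modulation z.2 (translation z₀.1 ψ) - modulation z₀.2 (translation z₀.1 ψ)) := by
      rw [map_sub, sub_add_sub_cancel]
      rfl
    rw [h1]
    refine (norm_add_le _ _).trans ?_
    rw [LinearIsometry.norm_map]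
  have hc : Continuous fun z : Phase d => ‖translation z.1 ψ - translation z₀.1 ψ‖
      + ‖modulation z.2 (translation z₀.1 ψ) - modulation z₀.2 (translation z₀.1 ψ)‖ := by
    have h1 := (continuous_translation ψ).comp (continuous_fst (X := Conf d) (Y := Conf d))
    have h2 := (continuous_modulation (translation z₀.1 ψ)).comp
      (continuous_snd (X := Conf d) (Y := Conf d))
    exact ((h1.sub continuous_const).norm).add ((h2.sub continuous_const).norm)
  have h0 := hc.tendsto z₀
  simp only [sub_self, norm_zero, add_zero] at h0
  exact squeeze_zero (fun z => norm_nonneg _) hb h0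

theorem continuous_adjoint_tfShift (ψ : Hilb d) :
    Continuous fun z : Phase d => ContinuousLinearMap.adjoint (tfShift z) ψ := by
  rw [continuous_iff_continuousAt]
  intro z₀
  refine tendsto_iff_norm_sub_tendsto_zero.2 ?_
  have h : ∀ z : Phase d,
      ‖ContinuousLinearMap.adjoint (tfShift z) ψ - ContinuousLinearMap.adjoint (tfShift z₀) ψ‖
        = ‖ψ - tfShift z (ContinuousLinearMap.adjoint (tfShift z₀) ψ)‖ := by
    intro z
    rw [← norm_tfShift z, map_sub, tfShift_apply_adjoint]
  simp_rw [h]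
  have hc : Continuous fun z : Phase d =>
      ‖ψ - tfShift z (ContinuousLinearMap.adjoint (tfShift z₀) ψ)‖ :=
    Continuous.norm (Continuous.sub (G := Hilb d) continuous_const (continuous_tfShift _))
  have h0 := hc.tendsto z₀
  rwa [tfShift_apply_adjoint, sub_self, norm_zero] at h0

theorem continuous_inner_shift (S : Op d) (ψ η : Hilb d) :
    Continuous fun z : Phase d => inner ℂ η (shift z S ψ) := by
  have h : ∀ z : Phase d, inner ℂ η (shift z S ψ)
      = inner ℂ (ContinuousLinearMap.adjoint (tfShift z) η)
          (S (ContinuousLinearMap.adjoint (tfShift z) ψ)) := by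
    intro z
    rw [ContinuousLinearMap.adjoint_inner_left]
    rfl
  simp_rw [h]
  exact (continuous_adjoint_tfShift η).inner (S.continuous.comp (continuous_adjoint_tfShift ψ))

theorem norm_inner_shift_le (S : Op d) (z : Phase d) (ψ η : Hilb d) :
    ‖(inner ℂ η (shift z S ψ) : ℂ)‖ ≤ ‖S‖ * ‖ψ‖ * ‖η‖ := by
  refine (norm_inner_le_norm _ _).trans ?_
  rw [mul_comm]
  refine mul_le_mul_of_nonneg_right ?_ (norm_nonneg _)
  change ‖tfShift z (S (ContinuousLinearMap.adjoint (tfShift z) ψ))‖ ≤ _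
  rw [norm_tfShift]
  refine (S.le_opNorm _).trans ?_
  rw [norm_adjoint_tfShift]

/-! ## Werner's convolutions -/

/-- The integrand of the weak definition of `f ∗ S` is integrable when `f` is. -/
theorem integrable_mul_inner_shift {f : Phase d → ℂ} (hf : Integrable f) (S : Op d)
    (ψ η : Hilb d) : Integrable fun y => f y * inner ℂ η (shift y S ψ) :=
  hf.mul_bdd (c := ‖S‖ * ‖ψ‖ * ‖η‖) (continuous_inner_shift S ψ η).aestronglyMeasurable
    (Filter.Eventually.of_forall fun y => norm_inner_shift_le S y ψ η)

theorem exists_weak_integral {f : Phase d → ℂ} (hf : Integrable f) (S : Op d) :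
    ∃ A : Op d, ∀ ψ η : Hilb d, inner ℂ η (A ψ) = ∫ y, f y * inner ℂ η (shift y S ψ) := by
  have hi := integrable_mul_inner_shift hf S
  let B : Hilb d →ₗ⋆[ℂ] Hilb d →ₗ[ℂ] ℂ :=
    LinearMap.mk₂'ₛₗ (starRingEnd ℂ) (RingHom.id ℂ)
      (fun η ψ => ∫ y, f y * inner ℂ η (shift y S ψ))
      (fun η η' ψ => by
        rw [← integral_add (hi ψ η) (hi ψ η')]
        simp only [inner_add_left, mul_add])
      (fun c η ψ => by
        rw [smul_eq_mul, ← integral_const_mul]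
        simp only [inner_smul_left, mul_left_comm])
      (fun η ψ ψ' => by
        rw [← integral_add (hi ψ η) (hi ψ' η)]
        simp only [map_add, inner_add_right, mul_add])
      (fun c η ψ => by
        rw [RingHom.id_apply, smul_eq_mul, ← integral_const_mul]
        simp only [map_smul, inner_smul_right, mul_left_comm])
  have hB : ∀ η ψ : Hilb d, ‖B η ψ‖ ≤ ((∫ y, ‖f y‖) * ‖S‖) * ‖η‖ * ‖ψ‖ := by
    intro η ψ
    calc ‖∫ y, f y * inner ℂ η (shift y S ψ)‖
        ≤ ∫ y, ‖f y‖ * (‖S‖ * ‖ψ‖ * ‖η‖) := by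
          refine norm_integral_le_of_norm_le (hf.norm.mul_const _) ?_
          filter_upwards with y
          rw [norm_mul]
          exact mul_le_mul_of_nonneg_left (norm_inner_shift_le S y ψ η) (norm_nonneg _)
      _ = _ := by rw [integral_mul_const]; ring
  let B' : Hilb d →L⋆[ℂ] Hilb d →L[ℂ] ℂ := B.mkContinuous₂ _ hB
  refine ⟨ContinuousLinearMap.adjoint (InnerProductSpace.continuousLinearMapOfBilin B'),
    fun ψ η => ?_⟩
  rw [ContinuousLinearMap.adjoint_inner_right,
    InnerProductSpace.continuousLinearMapOfBilin_apply]
  rfl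

open scoped Classical in
/-- The convolution `f ∗ S = ∫ f(y) α_y(S) dy` of a function and an operator, the integral being
taken in the weak sense: `f ∗ S` is the operator `A` with
`⟨A ψ, η⟩ = ∫ f(y) ⟨α_y(S) ψ, η⟩ dy` for all `ψ, η`. It exists whenever `f` is integrable. -/
def funOpConv (f : Phase d → ℂ) (S : Op d) : Op d :=
  if h : ∃ A : Op d, ∀ ψ η : Hilb d, inner ℂ η (A ψ) = ∫ y, f y * inner ℂ η (shift y S ψ)
  then h.choose else 0

theorem inner_funOpConv {f : Phase d → ℂ} (hf : Integrable f) (S : Op d) (ψ η : Hilb d) :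
    inner ℂ η (funOpConv f S ψ) = ∫ y, f y * inner ℂ η (shift y S ψ) := by
  have h := exists_weak_integral hf S
  rw [funOpConv, dif_pos h]
  exact h.choose_spec ψ η

/-- The convolution of two operators, the function `(S ∗ T)(z) = tr(S α_z(Ť))`. -/
def opConv (S T : Op d) (z : Phase d) : ℂ := tr (S.comp (shift z (check T)))

/-- The convolution of two functions on phase space, `(f ∗ h)(z) = ∫ f(y) h(z - y) dy`. -/
def funConv (f h : Phase d → ℂ) : Phase d → ℂ :=
  convolution f h (ContinuousLinearMap.mul ℂ ℂ) volume

/-! ## Fourier transforms -/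

/-- The standard symplectic form `[z, z'] = ω·x' - ω'·x`. -/
def symp (z z' : Phase d) : ℝ := inner ℝ z.2 z'.1 - inner ℝ z'.2 z.1

/-- The symplectic Fourier transform of a function on phase space. -/
def sympFourier (f : Phase d → ℂ) (z : Phase d) : ℂ :=
  ∫ z', f z' * Complex.exp (-2 * Real.pi * (symp z z' : ℝ) * Complex.I)

/-- The phase factor `e^{-πi x·ω}`. -/
def halfPhase (z : Phase d) : ℂ := Complex.exp (-Real.pi * (inner ℝ z.1 z.2 : ℝ) * Complex.I)

/-- The Fourier-Wigner transform `F_W(S)(z) = e^{-πi x·ω} tr(π(-z) S)`. -/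
def fourierWigner (S : Op d) (z : Phase d) : ℂ := halfPhase z * tr ((tfShift (-z)).comp S)

/-- The Weyl operator `W(z) = e^{-πi x·ω} π(z)`, so that `F_W(S)(z) = tr(W(z)^* S)`. -/
def weyl (z : Phase d) : Op d := halfPhase z • tfShift z

/-! ## Phase space representations -/

/-- `g` is the generalized Husimi representation `S_σ` of `S`: it is the integrable function with
symplectic Fourier transform `F(S_σ)(z) = tr(W(z) σ) F_W(S)(z)`. -/
def IsGenHusimi (σ S : Op d) (g : Phase d → ℂ) : Prop :=
  Integrable g ∧ ∀ z, sympFourier g z = tr ((weyl z).comp σ) * fourierWigner S z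

/-- `f` is a generalized Glauber-Sudarshan representation `S_{-σ}` of `S`: it is an integrable
function with symplectic Fourier transform `F(S_{-σ})(z) = F_W(S)(z) / tr(W(z)^* σ^*)`. The
denominator is cleared, so that its zeros are allowed. -/
def IsGenGlauberSudarshan (σ S : Op d) (f : Phase d → ℂ) : Prop :=
  Integrable f ∧ ∀ z, sympFourier f z *
    tr ((ContinuousLinearMap.adjoint (weyl z)).comp (ContinuousLinearMap.adjoint σ))
      = fourierWigner S z

/-- The Gaussian `φ(x) = 2^{d/4} e^{-π x·x}`, as a function. -/
def gaussianFun (d : ℕ) (x : Conf d) : ℂ :=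
  (((2 : ℝ) ^ ((d : ℝ) / 4) * Real.exp (-Real.pi * inner ℝ x x) : ℝ) : ℂ)

theorem memLp_gaussianFun (d : ℕ) : MemLp (gaussianFun d) 2 volume := by
  have hc : Continuous (gaussianFun d) := by
    unfold gaussianFun
    fun_prop
  rw [memLp_two_iff_integrable_sq_norm hc.aestronglyMeasurable]
  have h := (GaussianFourier.integrable_cexp_neg_mul_sq_norm_add (V := Conf d)
    (b := ((2 * Real.pi : ℝ) : ℂ)) (by simpa using Real.pi_pos) 0 0).norm
  refine (h.const_mul (((2 : ℝ) ^ ((d : ℝ) / 4)) ^ 2)).congr ?_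
  filter_upwards with x
  rw [gaussianFun, Complex.norm_real, Real.norm_eq_abs, sq_abs, mul_pow, ← Real.exp_nat_mul,
    Complex.norm_exp, real_inner_self_eq_norm_sq]
  congr 2
  simp [← Complex.ofReal_pow, ← Complex.ofReal_mul]
  ring

/-- The Gaussian `φ` as an element of `L²(ℝ^d)`. -/
def gaussian (d : ℕ) : Hilb d := (memLp_gaussianFun d).toLp (gaussianFun d)

/-- The rank-one operator `φ ⊗ φ`, that is, `ζ ↦ ⟨ζ, φ⟩ φ`. -/
def gaussianProj (d : ℕ) : Op d := InnerProductSpace.rankOne ℂ (gaussian d) (gaussian d)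

/-- The short-time Fourier transform `V_η ψ(z) = ⟨ψ, π(z) η⟩` with window `η`. -/
def stft (η ψ : Hilb d) (z : Phase d) : ℂ := inner ℂ (tfShift z η) ψ

/-- The Husimi representation `A_H(z) = ⟨A π(z) φ, π(z) φ⟩`. -/
def husimi (A : Op d) (z : Phase d) : ℂ :=
  inner ℂ (tfShift z (gaussian d)) (A (tfShift z (gaussian d)))

/-- `a` is a Glauber-Sudarshan representation of `A`: `A ψ = ∫ a(z) V_φ ψ(z) π(z) φ dz` for all
`ψ`, as a convergent vector-valued integral. -/
def IsGlauberSudarshan (A : Op d) (a : Phase d → ℂ) : Prop :=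
  ∀ ψ : Hilb d,
    Integrable (fun z => (a z * stft (gaussian d) ψ z) • tfShift z (gaussian d)) ∧
      A ψ = ∫ z, (a z * stft (gaussian d) ψ z) • tfShift z (gaussian d)

end

end PhaseSpace

open PhaseSpace

/-! Everything rests on one convolution theorem: for trace class `S` and `T`, the function z ↦ tr(S
α_z(T)) is integrable and its symplectic Fourier transform at w is tr(W(w)T) · F_W(S)(w)
(`sympFourier_tr_comp_shift`). To prove it, `S` and `T` are expanded in rank-one operators, which
turns the trace into a series of products of short-time Fourier transforms. Multiplying such a
product by a symplectic character only replaces two of its vectors by their images under W(w), so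
Moyal's identity (`integral_conj_mul_stft`) integrates every term.

For T = σ this is the defining property of S_σ, and injectivity of the transform on L¹ gives
uniqueness.

For the Glauber–Sudarshan side, `f ∗ σ^*` is used only as a bounded operator. Associativity with a
rank-one third factor (`funConv_tr_comp_shift`) computes the transform of its coefficients z ↦ ⟨(f ∗
σ^*)π(z)ξ, π(z)η⟩. These coefficients determine a bounded operator, so the transform equation for
`f` is equivalent to S = f ∗ σ^* (`isGenGlauberSudarshan_iff`), and the chain of identities in the
third claim is associativity again. Uniqueness holds because transforms of integrable functions are
continuous and are forced on a dense set.

For σ = φ ⊗ φ, α_z(σ) is the projection onto π(z)φ, which identifies both classical representations;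
an explicit Gaussian integral shows that F_W(σ) has no zeros. -/

namespace PhaseSpace

noncomputable section

/-! ### Nuclear representations and the trace -/

section Nuclear

open ContinuousLinearMap

variable {E : Type*} [NormedAddCommGroup E] [InnerProductSpace ℂ E]
  {ι : Type*}

/-- A nuclear representation `A = ∑ᵢ uᵢ ⊗ vᵢ`, absolutely convergent in trace norm. -/
structure IsNuclearRep (A : E →L[ℂ] E) (u v : ι → E) : Prop where
  summable : Summable fun i => ‖u i‖ * ‖v i‖
  hasSum : ∀ ψ, HasSum (fun i => (inner ℂ (v i) ψ : ℂ) • u i) (A ψ)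

/-- Orthonormality is given up and the singular values are absorbed into `u`: this weaker form,
unlike a singular value decomposition, survives composition with bounded operators. -/
theorem IsTraceClass.exists_isNuclearRep {S : E →L[ℂ] E} (hS : IsTraceClass S) :
    ∃ (ι : Set ℕ) (u v : ι → E), IsNuclearRep S u v := by
  obtain ⟨ι, s, u, v, hu, hv, hs, hsum, h⟩ := hS
  refine ⟨ι, fun i => (s i : ℂ) • u i, v, ?_, fun ψ => ?_⟩
  · refine hsum.congr fun i => ?_
    rw [norm_smul, hu.1 i, hv.1 i, Complex.norm_real, Real.norm_of_nonneg (hs i)]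
    ring
  · refine (h ψ).congr_fun fun i => ?_
    rw [smul_smul, mul_comm]

theorem isTraceClass_rankOne_self {x : E} (hx : ‖x‖ = 1) :
    IsTraceClass (InnerProductSpace.rankOne ℂ x x) := by
  refine ⟨{0}, fun _ => 1, fun _ => x, fun _ => x, ?_, ?_, fun _ => zero_le_one,
    Summable.of_finite, fun ψ => ?_⟩
  · exact ⟨fun _ => hx, fun i j hij => (hij (Subsingleton.elim i j)).elim⟩
  · exact ⟨fun _ => hx, fun i j hij => (hij (Subsingleton.elim i j)).elim⟩
  · simp

theorem isNuclearRep_rankOne (x y : E) :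
    IsNuclearRep (InnerProductSpace.rankOne ℂ x y) (fun _ : Unit => x) (fun _ => y) where
  summable := Summable.of_finite
  hasSum ψ := hasSum_unique fun _ : Unit => ((inner ℂ y ψ : ℂ) • x)

namespace IsNuclearRep

variable {A : E →L[ℂ] E} {u v : ι → E}

theorem comp_left (h : IsNuclearRep A u v) (B : E →L[ℂ] E) :
    IsNuclearRep (B.comp A) (fun i => B (u i)) v where
  summable := by
    refine (h.summable.mul_left ‖B‖).of_nonneg_of_le (fun i => by positivity) fun i => ?_
    rw [← mul_assoc]
    exact mul_le_mul_of_nonneg_right (B.le_opNorm _) (norm_nonneg _)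
  hasSum ψ := by
    have := (h.hasSum ψ).mapL B
    simpa using this

/-- For fixed `i`, Cauchy–Schwarz and Bessel bound the sum over the orthonormal system by ‖uᵢ‖‖vᵢ‖.
This is the absolute convergence behind the exchange of sums in `hasSum_tr`. -/
theorem summable_norm_inner_mul_inner (h : IsNuclearRep A u v) {κ : Type*} {b : κ → E}
    (hb : Orthonormal ℂ b) :
    Summable fun p : ι × κ => ‖(inner ℂ (v p.1) (b p.2) * inner ℂ (b p.2) (u p.1) : ℂ)‖ := by
  have hbound : ∀ i (s : Finset κ),
      ∑ e ∈ s, ‖(inner ℂ (v i) (b e) * inner ℂ (b e) (u i) : ℂ)‖ ≤ ‖u i‖ * ‖v i‖ := by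
    intro i s
    have h1 := hb.sum_inner_products_le (x := v i) (s := s)
    have h2 := hb.sum_inner_products_le (x := u i) (s := s)
    calc ∑ e ∈ s, ‖(inner ℂ (v i) (b e) * inner ℂ (b e) (u i) : ℂ)‖
        = ∑ e ∈ s, ‖(inner ℂ (b e) (v i) : ℂ)‖ * ‖(inner ℂ (b e) (u i) : ℂ)‖ :=
          Finset.sum_congr rfl fun e _ => by rw [norm_mul, norm_inner_symm]
      _ ≤ √(∑ e ∈ s, ‖(inner ℂ (b e) (v i) : ℂ)‖ ^ 2) *
            √(∑ e ∈ s, ‖(inner ℂ (b e) (u i) : ℂ)‖ ^ 2) := Real.sum_mul_le_sqrt_mul_sqrt _ _ _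
      _ ≤ ‖v i‖ * ‖u i‖ := by
          gcongr
          · exact Real.sqrt_le_iff.2 ⟨norm_nonneg _, h1⟩
          · exact Real.sqrt_le_iff.2 ⟨norm_nonneg _, h2⟩
      _ = _ := mul_comm _ _
  refine (summable_prod_of_nonneg fun _ => norm_nonneg _).2
    ⟨fun i => summable_of_sum_le (fun _ => norm_nonneg _) (hbound i), ?_⟩
  exact h.summable.of_nonneg_of_le (fun i => tsum_nonneg fun _ => norm_nonneg _) fun i =>
    Real.tsum_le_of_sum_le (fun _ => norm_nonneg _) (hbound i)

theorem summable_inner (h : IsNuclearRep A u v) : Summable fun i => (inner ℂ (v i) (u i) : ℂ) := by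
  refine Summable.of_norm_bounded h.summable fun i => ?_
  rw [mul_comm]
  exact norm_inner_le_norm _ _

variable [CompleteSpace E]

theorem comp_right (h : IsNuclearRep A u v) (B : E →L[ℂ] E) :
    IsNuclearRep (A.comp B) u (fun i => adjoint B (v i)) where
  summable := by
    refine (h.summable.mul_left ‖adjoint B‖).of_nonneg_of_le (fun i => by positivity) fun i => ?_
    rw [mul_left_comm]
    exact mul_le_mul_of_nonneg_left ((adjoint B).le_opNorm _) (norm_nonneg _)
  hasSum ψ := by simpa [adjoint_inner_left] using h.hasSum (B ψ)

theorem adjoint (h : IsNuclearRep A u v) : IsNuclearRep (adjoint A) v u where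
  summable := by simpa only [mul_comm] using h.summable
  hasSum ψ := by
    have hs : Summable fun i => (inner ℂ (u i) ψ : ℂ) • v i := by
      refine Summable.of_norm_bounded (h.summable.mul_left ‖ψ‖) fun i => ?_
      rw [norm_smul, ← mul_assoc, mul_comm ‖ψ‖]
      exact mul_le_mul_of_nonneg_right (norm_inner_le_norm _ _) (norm_nonneg _)
    convert hs.hasSum using 1
    -- The sum of the vector series is identified by pairing with `η`, which gives the series of ⟨ψ,
    -- A η⟩.
    refine ext_inner_right ℂ fun η => ?_
    rw [adjoint_inner_left]
    have h1 := (h.hasSum η).mapL (innerSL ℂ ψ)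
    have h2 := ((hs.hasSum.mapL (innerSL ℂ η)).star)
    refine h1.unique ?_
    convert! h2 using 1
    · ext i
      simp [mul_comm]
    · simp

/-- The trace does not depend on the basis. -/
theorem hasSum_tr (h : IsNuclearRep A u v) : HasSum (fun i => (inner ℂ (v i) (u i) : ℂ)) (tr A) := by
  convert h.summable_inner.hasSum using 1
  set b := (exists_hilbertBasis ℂ E).choose_spec.choose with hb
  have hs := (h.summable_norm_inner_mul_inner b.orthonormal).of_norm
  have h1 : ∀ e, inner ℂ (b e) (A (b e)) = ∑' i, inner ℂ (v i) (b e) * inner ℂ (b e) (u i) := by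
    intro e
    have := (h.hasSum (b e)).mapL (innerSL ℂ (b e))
    rw [← innerSL_apply_apply ℂ, ← this.tsum_eq]
    simp
  rw [tr]
  simp_rw [← hb, h1]
  -- Fubini for the double series; what remains for each `i` is Parseval's identity.
  refine (Summable.tsum_comm' (f := fun i e => inner ℂ (v i) (b e) * inner ℂ (b e) (u i))
    hs (fun i => hs.prod_factor i) (fun e => hs.prod_symm.prod_factor e)).trans ?_
  exact tsum_congr fun i => b.tsum_inner_mul_inner _ _

theorem hasSum_tr_comp_left (h : IsNuclearRep A u v) (B : E →L[ℂ] E) :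
    HasSum (fun i => (inner ℂ (v i) (B (u i)) : ℂ)) (tr (B.comp A)) :=
  (h.comp_left B).hasSum_tr

/-- Termwise ⟨B^* vᵢ, uᵢ⟩ = ⟨vᵢ, B uᵢ⟩, so both traces sum the same series. -/
theorem tr_comp_comm (h : IsNuclearRep A u v) (B : E →L[ℂ] E) :
    tr (A.comp B) = tr (B.comp A) := by
  refine (h.comp_right B).hasSum_tr.unique ?_
  simpa only [adjoint_inner_left] using h.hasSum_tr_comp_left B

end IsNuclearRep

variable [CompleteSpace E]

theorem tr_comp_rankOne (A : E →L[ℂ] E) (x y : E) :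
    tr (A.comp (InnerProductSpace.rankOne ℂ x y)) = inner ℂ y (A x) :=
  ((isNuclearRep_rankOne x y).hasSum_tr_comp_left A).unique (hasSum_unique _)

theorem tr_adjoint (A : E →L[ℂ] E) : tr (adjoint A) = (starRingEnd ℂ) (tr A) := by
  rw [tr, tr, Complex.conj_tsum]
  exact tsum_congr fun e => by rw [adjoint_inner_right, inner_conj_symm]

end Nuclear

/-! ### Fourier uniqueness on L¹ and Plancherel on L¹ ∩ L² -/

section Fourier

open scoped FourierTransform ContDiff

/-- A real integrable function is determined by its characteristic function. -/
theorem ae_eq_zero_of_integral_char_eq_zero_real {E : Type*} [NormedAddCommGroup E]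
    [NormedSpace ℝ E] [CompleteSpace E] [SecondCountableTopology E] [MeasurableSpace E]
    [BorelSpace E] {μ : Measure E} {f : E → ℝ} (hf : Integrable f μ)
    (h : ∀ L : StrongDual ℝ E, ∫ v, (f v : ℂ) * Complex.exp (L v * Complex.I) ∂μ = 0) :
    f =ᵐ[μ] 0 := by
  have hchar : ∀ g : E → ℝ, Integrable g μ → ∀ L : StrongDual ℝ E,
      charFunDual (μ.withDensity fun v => ENNReal.ofReal (g v)) L
        = ∫ v, ((max (g v) 0 : ℝ) : ℂ) * Complex.exp (L v * Complex.I) ∂μ := by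
    intro g hg L
    rw [charFunDual_apply, integral_withDensity_eq_integral_toReal_smul₀
      hg.aemeasurable.ennreal_ofReal (Filter.Eventually.of_forall fun _ => ENNReal.ofReal_lt_top)]
    refine integral_congr_ae (Filter.Eventually.of_forall fun v => ?_)
    simp only [ENNReal.toReal_ofReal', Complex.real_smul]
  have hcharInt : ∀ g : E → ℝ, Integrable g μ → ∀ L : StrongDual ℝ E,
      Integrable (fun v => ((max (g v) 0 : ℝ) : ℂ) * Complex.exp (L v * Complex.I)) μ := by
    intro g hg L
    refine (hg.pos_part.ofReal (𝕜 := ℂ)).mul_bdd (c := 1) ?_ (Filter.Eventually.of_forall fun v => ?_)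
    · exact Continuous.aestronglyMeasurable (by fun_prop)
    · rw [Complex.norm_exp_ofReal_mul_I]
  have hfin : ∀ g : E → ℝ, Integrable g μ →
      IsFiniteMeasure (μ.withDensity fun v => ENNReal.ofReal (g v)) := fun g hg =>
    isFiniteMeasure_withDensity_ofReal hg.2
  have := hfin f hf
  have := hfin (-f) hf.neg
  -- The positive and negative parts of `f` are densities of finite measures with equal
  -- characteristic functions, so the measures coincide.
  have heq : (μ.withDensity fun v => ENNReal.ofReal (f v))
      = μ.withDensity fun v => ENNReal.ofReal ((-f) v) := by
    refine Measure.ext_of_charFunDual (funext fun L => ?_)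
    rw [hchar f hf, hchar (-f) hf.neg, ← sub_eq_zero,
      ← integral_sub (hcharInt f hf L) (hcharInt (-f) hf.neg L), ← h L]
    refine integral_congr_ae (Filter.Eventually.of_forall fun v => ?_)
    simp only [← sub_mul, ← Complex.ofReal_sub, Pi.neg_apply]
    rw [max_zero_sub_max_neg_zero_eq_self]
  have hfi : ∫⁻ v, ENNReal.ofReal (f v) ∂μ ≠ ⊤ := by
    simpa using measure_ne_top (μ.withDensity fun v => ENNReal.ofReal (f v)) Set.univ
  filter_upwards [(withDensity_eq_iff hf.aemeasurable.ennreal_ofReal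
    hf.neg.aemeasurable.ennreal_ofReal hfi).1 heq] with v hv
  rcases le_total (f v) 0 with h0 | h0
  · rw [ENNReal.ofReal_of_nonpos h0] at hv
    have := ENNReal.ofReal_eq_zero.1 hv.symm
    simp only [Pi.neg_apply] at this
    simp only [Pi.zero_apply]
    linarith
  · rw [ENNReal.ofReal_of_nonpos (p := (-f) v) (by simpa using h0)] at hv
    exact le_antisymm (ENNReal.ofReal_eq_zero.1 hv) h0

/-- A complex integrable function is determined by its characteristic function. -/
theorem ae_eq_zero_of_integral_char_eq_zero {E : Type*} [NormedAddCommGroup E]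
    [NormedSpace ℝ E] [CompleteSpace E] [SecondCountableTopology E] [MeasurableSpace E]
    [BorelSpace E] {μ : Measure E} {f : E → ℂ} (hf : Integrable f μ)
    (h : ∀ L : StrongDual ℝ E, ∫ v, f v * Complex.exp (L v * Complex.I) ∂μ = 0) :
    f =ᵐ[μ] 0 := by
  have hb : ∀ L : StrongDual ℝ E, Integrable (fun v => f v * Complex.exp (L v * Complex.I)) μ := by
    intro L
    refine hf.mul_bdd (c := 1) (Continuous.aestronglyMeasurable (by fun_prop))
      (Filter.Eventually.of_forall fun v => ?_)
    rw [Complex.norm_exp_ofReal_mul_I]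
  -- Conjugation exchanges `L` and `-L`, so the conjugate of `f` satisfies the same hypothesis, and
  -- with it the real and imaginary parts.
  have hconj : ∀ L : StrongDual ℝ E,
      ∫ v, (starRingEnd ℂ) (f v) * Complex.exp (L v * Complex.I) ∂μ = 0 := by
    intro L
    have := congrArg (starRingEnd ℂ) (h (-L))
    rw [← integral_conj, map_zero] at this
    rw [← this]
    refine integral_congr_ae (Filter.Eventually.of_forall fun v => ?_)
    simp [← Complex.exp_conj]
  have hb' : ∀ L : StrongDual ℝ E,
      Integrable (fun v => (starRingEnd ℂ) (f v) * Complex.exp (L v * Complex.I)) μ := by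
    intro L
    refine (Complex.conjLIE.toContinuousLinearEquiv.toContinuousLinearMap.integrable_comp
      hf).mul_bdd (c := 1) (Continuous.aestronglyMeasurable (by fun_prop))
      (Filter.Eventually.of_forall fun v => ?_)
    rw [Complex.norm_exp_ofReal_mul_I]
  have hre : (fun v => (f v).re) =ᵐ[μ] 0 := by
    refine ae_eq_zero_of_integral_char_eq_zero_real hf.re fun L => ?_
    have := integral_add (hb L) (hb' L)
    rw [h, hconj, add_zero] at this
    rw [← mul_eq_zero_iff_left (two_ne_zero (α := ℂ)), ← integral_const_mul, ← this]
    refine integral_congr_ae (Filter.Eventually.of_forall fun v => ?_)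
    simp only [← add_mul, Complex.add_conj]
    push_cast
    ring
  have him : (fun v => (f v).im) =ᵐ[μ] 0 := by
    refine ae_eq_zero_of_integral_char_eq_zero_real hf.im fun L => ?_
    have := integral_sub (hb L) (hb' L)
    rw [h, hconj, sub_zero] at this
    rw [← mul_eq_zero_iff_left (mul_ne_zero (two_ne_zero (α := ℂ)) Complex.I_ne_zero),
      ← integral_const_mul, ← this]
    refine integral_congr_ae (Filter.Eventually.of_forall fun v => ?_)
    simp only [← sub_mul, Complex.sub_conj]
    push_cast
    ring
  filter_upwards [hre, him] with v h1 h2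
  exact Complex.ext h1 h2

variable {V : Type*} [NormedAddCommGroup V] [InnerProductSpace ℝ V] [FiniteDimensional ℝ V]
  [MeasurableSpace V] [BorelSpace V]

/-- On `L¹ ∩ L²` the Fourier transform of `L²` is given by the Fourier integral. -/
theorem fourier_toLp_two_ae_eq {h : V → ℂ} (h1 : Integrable h) (h2 : MemLp h 2) :
    (𝓕 (h2.toLp h) : Lp ℂ 2 (volume : Measure V)) =ᵐ[volume] 𝓕 h := by
  have hcont : Continuous (𝓕 h) :=
    VectorFourier.fourierIntegral_continuous Real.continuous_fourierChar
      (by exact continuous_inner) h1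
  -- Both sides are tested against smooth compactly supported `g`: the distributional definition
  -- moves the transform onto `g`, and the flip formula for Fourier integrals moves it back onto
  -- `h`.
  refine ae_eq_of_integral_contDiff_smul_eq
    ((Lp.memLp (𝓕 (h2.toLp h) : Lp ℂ 2 (volume : Measure V))).locallyIntegrable (by norm_num))
    hcont.locallyIntegrable fun g hg hgs => ?_
  let G : SchwartzMap V ℂ := HasCompactSupport.toSchwartzMap (f := fun x => (g x : ℂ))
    (hgs.comp_left Complex.ofReal_zero) (Complex.ofRealCLM.contDiff.comp hg)
  have hG : ∀ x, G x = (g x : ℂ) := fun x => rfl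
  have key := congrArg (fun T => T G) (Lp.fourier_toTemperedDistribution_eq (h2.toLp h))
  simp only [TemperedDistribution.fourier_apply, Lp.toTemperedDistribution_apply] at key
  have e1 : ∫ x, g x • (𝓕 (h2.toLp h) : Lp ℂ 2 (volume : Measure V)) x
      = ∫ x, G x • (𝓕 (h2.toLp h) : Lp ℂ 2 (volume : Measure V)) x :=
    integral_congr_ae (Filter.Eventually.of_forall fun x => by simp [hG])
  rw [e1, ← key]
  have e2 : ∫ x, (𝓕 G : SchwartzMap V ℂ) x • (h2.toLp h) x = ∫ x, h x • 𝓕 (G : V → ℂ) x := by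
    refine integral_congr_ae ?_
    filter_upwards [h2.coeFn_toLp] with x hx
    rw [hx, SchwartzMap.fourier_coe, smul_eq_mul, smul_eq_mul, mul_comm]
  rw [e2]
  have e3 := VectorFourier.integral_fourierIntegral_smul_eq_flip (μ := (volume : Measure V))
    (ν := (volume : Measure V)) (L := innerₗ V) (f := h) (g := (G : V → ℂ))
    Real.continuous_fourierChar (by exact continuous_inner) h1 G.integrable
  rw [flip_innerₗ] at e3
  refine e3.symm.trans (integral_congr_ae (Filter.Eventually.of_forall fun x => ?_))
  simp only [hG, smul_eq_mul, Complex.real_smul]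
  exact mul_comm _ _

theorem memLp_two_fourier {h : V → ℂ} (h1 : Integrable h) (h2 : MemLp h 2) : MemLp (𝓕 h) 2 :=
  (memLp_congr_ae (fourier_toLp_two_ae_eq h1 h2)).1 (Lp.memLp _)

theorem integral_conj_mul_fourier {g h : V → ℂ} (g1 : Integrable g) (g2 : MemLp g 2)
    (h1 : Integrable h) (h2 : MemLp h 2) :
    ∫ w, (starRingEnd ℂ) (𝓕 g w) * 𝓕 h w = ∫ t, (starRingEnd ℂ) (g t) * h t := by
  have := Lp.inner_fourier_eq (g2.toLp g) (h2.toLp h)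
  rw [L2.inner_def, L2.inner_def] at this
  refine Eq.trans (integral_congr_ae ?_) (this.trans (integral_congr_ae ?_))
  · filter_upwards [fourier_toLp_two_ae_eq g1 g2, fourier_toLp_two_ae_eq h1 h2] with t e1 e2
    rw [e1, e2, RCLike.inner_apply']
  · filter_upwards [g2.coeFn_toLp, h2.coeFn_toLp] with t e1 e2
    rw [e1, e2, RCLike.inner_apply']

end Fourier

/-! ### Short-time Fourier transforms and Moyal's identity -/

section STFT

open scoped FourierTransform

variable {d : ℕ}

/-- The map `(x, t) ↦ (t - x, t)` preserves Lebesgue measure. -/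
theorem measurePreserving_shear : MeasurePreserving
    (fun p : Conf d × Conf d => (p.2 - p.1, p.2)) volume volume := by
  have := (measurePreserving_prod_add_swap (volume : Measure (Conf d)) volume).comp
    (measurePreserving_prod_sub (volume : Measure (Conf d)) (volume : Measure (Conf d)))
  convert! this using 1
  ext p : 1
  simp

theorem integrable_shear {F G : Conf d → ℂ} (hF : Integrable F) (hG : Integrable G) :
    Integrable (fun p : Conf d × Conf d => F (p.2 - p.1) * G p.2) :=
  (measurePreserving_shear.integrable_comp (hF.mul_prod hG).1).2 (hF.mul_prod hG)

theorem integral_shear {F G : Conf d → ℂ} (hF : Integrable F) (hG : Integrable G) :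
    ∫ x, ∫ t, F (t - x) * G t = (∫ t, F t) * ∫ t, G t := by
  rw [← integral_prod_mul, ← Measure.volume_eq_prod, ← measurePreserving_shear.map_eq,
    integral_map measurePreserving_shear.aemeasurable
      (by rw [measurePreserving_shear.map_eq]; exact (hF.mul_prod hG).1)]
  exact (integral_prod _ (integrable_shear hF hG)).symm

/-- The function whose Fourier transform is the short-time Fourier transform at position `x`. -/
def windowed (η ψ : Hilb d) (x t : Conf d) : ℂ := (starRingEnd ℂ) (η (t - x)) * ψ t

theorem stft_eq_integral (η ψ : Hilb d) (x ω : Conf d) :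
    stft η ψ (x, ω) = 𝓕 (windowed η ψ x) ω := by
  rw [stft, L2.inner_def, Real.fourier_eq']
  refine integral_congr_ae ?_
  filter_upwards [tfShift_coe (x, ω) η] with t ht
  rw [ht, RCLike.inner_apply', map_mul, windowed, character, ← Complex.exp_conj, smul_eq_mul,
    ← mul_assoc]
  congr 3
  simp [real_inner_comm, Complex.conj_ofNat]

theorem aestronglyMeasurable_comp_sub (η : Hilb d) (x : Conf d) :
    AEStronglyMeasurable (fun t => η (t - x)) volume :=
  (Lp.aestronglyMeasurable η).comp_measurePreserving (measurePreserving_sub_right volume x)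

theorem aestronglyMeasurable_windowed (η ψ : Hilb d) (x : Conf d) :
    AEStronglyMeasurable (windowed η ψ x) volume :=
  (Complex.continuous_conj.comp_aestronglyMeasurable (aestronglyMeasurable_comp_sub η x)).mul
    (Lp.aestronglyMeasurable ψ)

theorem integrable_windowed (η ψ : Hilb d) (x : Conf d) : Integrable (windowed η ψ x) := by
  refine (L2.integrable_inner (𝕜 := ℂ) (translation x η) ψ).congr ?_
  filter_upwards [translation_coe x η] with t ht
  rw [ht, RCLike.inner_apply', windowed]

theorem integrable_conj_mul (ψ₁ ψ₂ : Hilb d) :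
    Integrable (fun t => (starRingEnd ℂ) (ψ₁ t) * ψ₂ t) := by
  simpa only [RCLike.inner_apply'] using L2.integrable_inner (𝕜 := ℂ) ψ₁ ψ₂

/-- The integrand regroups as a function of t - x times a function of t, both in L¹, which the shear
makes a tensor product. -/
theorem integrable_windowed_mul (η₁ ψ₁ η₂ ψ₂ : Hilb d) :
    Integrable (fun p : Conf d × Conf d =>
      (starRingEnd ℂ) (windowed η₁ ψ₁ p.1 p.2) * windowed η₂ ψ₂ p.1 p.2) := by
  refine (integrable_shear (integrable_conj_mul η₂ η₁) (integrable_conj_mul ψ₁ ψ₂)).congr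
    (Filter.Eventually.of_forall fun p => ?_)
  simp only [windowed, map_mul, Complex.conj_conj]
  ring

theorem integral_windowed_mul (η₁ ψ₁ η₂ ψ₂ : Hilb d) :
    ∫ x, ∫ t, (starRingEnd ℂ) (windowed η₁ ψ₁ x t) * windowed η₂ ψ₂ x t
      = inner ℂ ψ₁ ψ₂ * inner ℂ η₂ η₁ := by
  rw [L2.inner_def, L2.inner_def, mul_comm]
  simp_rw [RCLike.inner_apply']
  rw [← integral_shear (integrable_conj_mul η₂ η₁) (integrable_conj_mul ψ₁ ψ₂)]
  simp only [windowed, map_mul, Complex.conj_conj]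
  congr! 4
  ring

/-- A product of two L² functions need not be in L², so only Fubini helps and only for almost every
`x`. Plancherel in ω is therefore applied almost everywhere in `x`. -/
theorem ae_memLp_windowed (η ψ : Hilb d) : ∀ᵐ x, MemLp (windowed η ψ x) 2 := by
  filter_upwards [(integrable_windowed_mul η ψ η ψ).prod_right_ae] with x hx
  rw [memLp_two_iff_integrable_sq_norm (aestronglyMeasurable_windowed η ψ x)]
  refine hx.norm.congr (Filter.Eventually.of_forall fun t => ?_)
  simp [sq]

theorem continuous_stft (η ψ : Hilb d) : Continuous (stft η ψ) :=
  (continuous_tfShift η).inner continuous_const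

theorem ae_integral_conj_mul_stft (η₁ ψ₁ η₂ ψ₂ : Hilb d) : ∀ᵐ x : Conf d,
    ∫ ω, (starRingEnd ℂ) (stft η₁ ψ₁ (x, ω)) * stft η₂ ψ₂ (x, ω)
      = ∫ t, (starRingEnd ℂ) (windowed η₁ ψ₁ x t) * windowed η₂ ψ₂ x t := by
  filter_upwards [ae_memLp_windowed η₁ ψ₁, ae_memLp_windowed η₂ ψ₂] with x h1 h2
  simp_rw [stft_eq_integral]
  exact integral_conj_mul_fourier (integrable_windowed _ _ _) h1 (integrable_windowed _ _ _) h2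

theorem memLp_stft (η ψ : Hilb d) : MemLp (stft η ψ) 2 := by
  rw [memLp_two_iff_integrable_sq_norm (continuous_stft η ψ).aestronglyMeasurable,
    Measure.volume_eq_prod, integrable_prod_iff
    (by exact ((continuous_stft η ψ).norm.pow 2).aestronglyMeasurable)]
  constructor
  · filter_upwards [ae_memLp_windowed η ψ] with x hx
    have := (memLp_two_fourier (integrable_windowed η ψ x) hx).integrable_norm_pow (by norm_num)
    simpa [stft_eq_integral] using this
  -- By Plancherel the integral of |V_η ψ|² over ω is, for almost every `x`, that of the squared
  -- windowed function over `t`.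
  · refine (integrable_windowed_mul η ψ η ψ).integral_prod_left.norm.congr ?_
    filter_upwards [ae_integral_conj_mul_stft η ψ η ψ] with x hx
    rw [← hx]
    have : ∀ ω, (starRingEnd ℂ) (stft η ψ (x, ω)) * stft η ψ (x, ω)
        = ((‖stft η ψ (x, ω)‖ ^ 2 : ℝ) : ℂ) := fun ω => by
      rw [Complex.conj_mul', Complex.ofReal_pow]
    simp_rw [this]
    rw [integral_complex_ofReal]
    simp only [norm_pow, norm_norm, Complex.norm_real]
    exact Real.norm_of_nonneg (integral_nonneg fun ω => sq_nonneg _)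

theorem integrable_conj_mul_stft (η₁ ψ₁ η₂ ψ₂ : Hilb d) :
    Integrable (fun z => (starRingEnd ℂ) (stft η₁ ψ₁ z) * stft η₂ ψ₂ z) := by
  exact (memLp_stft η₁ ψ₁).star.integrable_mul (memLp_stft η₂ ψ₂)

/-- Moyal's identity. -/
theorem integral_conj_mul_stft (η₁ ψ₁ η₂ ψ₂ : Hilb d) :
    ∫ z, (starRingEnd ℂ) (stft η₁ ψ₁ z) * stft η₂ ψ₂ z = inner ℂ ψ₁ ψ₂ * inner ℂ η₂ η₁ := by
  rw [← integral_windowed_mul, Measure.volume_eq_prod, integral_prod _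
    (integrable_conj_mul_stft η₁ ψ₁ η₂ ψ₂)]
  exact integral_congr_ae (ae_integral_conj_mul_stft η₁ ψ₁ η₂ ψ₂)

theorem integral_norm_sq_stft (η ψ : Hilb d) :
    ∫ z, ‖stft η ψ z‖ ^ 2 = (‖η‖ * ‖ψ‖) ^ 2 := by
  have := integral_conj_mul_stft η ψ η ψ
  simp_rw [Complex.conj_mul', ← Complex.ofReal_pow] at this
  rw [integral_complex_ofReal, inner_self_eq_norm_sq_to_K, inner_self_eq_norm_sq_to_K] at this
  refine Complex.ofReal_injective (this.trans ?_)
  simp only [Complex.coe_algebraMap]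
  push_cast
  ring

/-- Cauchy–Schwarz and Moyal. The bound is summable over all pairs of rank-one terms of two nuclear
representations. -/
theorem integral_norm_mul_stft_le (η₁ ψ₁ η₂ ψ₂ : Hilb d) :
    ∫ z, ‖(starRingEnd ℂ) (stft η₁ ψ₁ z) * stft η₂ ψ₂ z‖ ≤ ‖η₁‖ * ‖ψ₁‖ * (‖η₂‖ * ‖ψ₂‖) := by
  have h := integral_mul_le_Lp_mul_Lq_of_nonneg (μ := (volume : Measure (Phase d)))
    (p := 2) (q := 2) (Real.HolderConjugate.two_two)
    (f := fun z => ‖stft η₁ ψ₁ z‖) (g := fun z => ‖stft η₂ ψ₂ z‖)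
    (Filter.Eventually.of_forall fun _ => norm_nonneg _)
    (Filter.Eventually.of_forall fun _ => norm_nonneg _)
    (by simpa using (memLp_stft η₁ ψ₁).norm) (by simpa using (memLp_stft η₂ ψ₂).norm)
  simp only [Real.rpow_two, integral_norm_sq_stft, ← Real.sqrt_eq_rpow] at h
  rw [Real.sqrt_sq (by positivity), Real.sqrt_sq (by positivity)] at h
  simpa using h

end STFT

/-! ### Commutation relations of time-frequency shifts and Weyl operators -/

section Shifts

open ContinuousLinearMap

variable {d : ℕ}

theorem check_check (A : Op d) : check (check A) = A := by
  have h : ∀ ψ : Hilb d, parity (parity ψ) = ψ := by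
    intro ψ
    refine Lp.ext ?_
    have h2 := (Measure.measurePreserving_neg
      (volume : Measure (Conf d))).quasiMeasurePreserving.ae_eq_comp (parity_coe ψ)
    filter_upwards [parity_coe (parity ψ), h2] with t h1 h2
    rw [h1]
    simpa using h2
  ext1 ψ
  simp [check, h]

theorem opConv_check (S T : Op d) (z : Phase d) :
    opConv S (check T) z = tr (S.comp (shift z T)) := by
  rw [opConv, check_check]

theorem character_add_right (ω t s : Conf d) :
    character ω (t + s) = character ω t * character ω s := by
  rw [character, character, character, ← Complex.exp_add, inner_add_right]
  push_cast
  ring_nf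

theorem character_add_left (ω ω' t : Conf d) :
    character (ω + ω') t = character ω t * character ω' t := by
  rw [character, character, character, ← Complex.exp_add, inner_add_left]
  push_cast
  ring_nf

theorem tfShift_tfShift (z w : Phase d) (ψ : Hilb d) :
    tfShift z (tfShift w ψ) = character w.2 (-z.1) • tfShift (z + w) ψ := by
  refine Lp.ext ?_
  have h2 := (measurePreserving_sub_right volume z.1).quasiMeasurePreserving.ae_eq_comp
    (tfShift_coe w ψ)
  filter_upwards [tfShift_coe z (tfShift w ψ), h2, tfShift_coe (z + w) ψ,
    Lp.coeFn_smul (character w.2 (-z.1)) (tfShift (z + w) ψ)] with t h1 h2 h3 h4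
  have h2' : (tfShift w ψ) (t - z.1) = character w.2 (t - z.1) * ψ (t - z.1 - w.1) := h2
  rw [h1, h4, Pi.smul_apply, h3, h2', sub_eq_add_neg t z.1, character_add_right, Prod.fst_add,
    Prod.snd_add, character_add_left, smul_eq_mul, ← sub_sub, sub_eq_add_neg t z.1]
  ring

theorem tfShift_zero (ψ : Hilb d) : tfShift 0 ψ = ψ := by
  refine Lp.ext ?_
  filter_upwards [tfShift_coe 0 ψ] with t h
  simp [h, character]

theorem inner_tfShift_tfShift (z : Phase d) (ψ η : Hilb d) :
    inner ℂ (tfShift z ψ) (tfShift z η) = (inner ℂ ψ η : ℂ) :=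
  ((modulation z.2).comp (translation z.1)).inner_map_map ψ η

theorem adjoint_tfShift_apply (z : Phase d) (ψ : Hilb d) :
    adjoint (tfShift z) (tfShift z ψ) = ψ :=
  ext_inner_left ℂ fun η => by rw [adjoint_inner_right, inner_tfShift_tfShift]

theorem adjoint_tfShift (z : Phase d) (ψ : Hilb d) :
    adjoint (tfShift z) ψ = character z.2 (-z.1) • tfShift (-z) ψ := by
  have h := tfShift_tfShift (-z) z (adjoint (tfShift z) ψ)
  rw [tfShift_apply_adjoint, neg_add_cancel, tfShift_zero, Prod.fst_neg, neg_neg] at h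
  rw [h, smul_smul, ← character_add_right, neg_add_cancel]
  simp [character]

theorem weyl_apply (z : Phase d) (ψ : Hilb d) : weyl z ψ = halfPhase z • tfShift z ψ := rfl

theorem norm_halfPhase (z : Phase d) : ‖halfPhase z‖ = 1 := by
  have h : (-Real.pi * (inner ℝ z.1 z.2 : ℝ) * Complex.I : ℂ)
      = ((-Real.pi * inner ℝ z.1 z.2 : ℝ) : ℂ) * Complex.I := by push_cast; ring
  rw [halfPhase, h, Complex.norm_exp_ofReal_mul_I]

theorem inner_weyl_weyl (z : Phase d) (ψ η : Hilb d) :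
    inner ℂ (weyl z ψ) (weyl z η) = (inner ℂ ψ η : ℂ) := by
  rw [weyl_apply, weyl_apply, inner_smul_left, inner_smul_right, ← mul_assoc, Complex.conj_mul',
    norm_halfPhase, inner_tfShift_tfShift]
  simp

theorem adjoint_weyl_apply (z : Phase d) (ψ : Hilb d) :
    adjoint (weyl z) ψ = halfPhase z • tfShift (-z) ψ := by
  rw [weyl, map_smulₛₗ, smul_apply, adjoint_tfShift, smul_smul]
  congr 1
  rw [halfPhase, character, ← Complex.exp_conj, ← Complex.exp_add, inner_neg_right]
  congr 1
  simp [real_inner_comm]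
  ring

/-- The half phase takes up exactly the scalar in `adjoint_tfShift` and is even in `z`, so no phase
is left over. -/
theorem adjoint_weyl (z : Phase d) : adjoint (weyl z) = weyl (-z) := by
  ext1 ψ
  rw [adjoint_weyl_apply, weyl_apply]
  simp [halfPhase]

theorem fourierWigner_eq (S : Op d) (z : Phase d) :
    fourierWigner S z = tr ((adjoint (weyl z)).comp S) := by
  rw [fourierWigner, tr, tr, ← tsum_mul_left]
  refine tsum_congr fun e => ?_
  rw [comp_apply, comp_apply, adjoint_weyl_apply, inner_smul_right]

/-- Both products are multiples of π(z + w); the ratio of the two scalars is the symplectic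
character. -/
theorem tfShift_weyl (z w : Phase d) (ψ : Hilb d) :
    tfShift z (weyl w ψ)
      = Complex.exp (-2 * Real.pi * (symp w z : ℝ) * Complex.I) • weyl w (tfShift z ψ) := by
  rw [weyl_apply, weyl_apply, map_smul, tfShift_tfShift, tfShift_tfShift, smul_smul, smul_smul,
    smul_smul, add_comm w z, mul_comm (halfPhase w), mul_right_comm, character, character,
    ← Complex.exp_add]
  congr 3
  simp only [symp, inner_neg_right]
  push_cast
  ring

/-- Multiplying a matrix coefficient of `π` by a character amounts to conjugating by `W(w)`. -/
theorem stft_mul_exp (w z : Phase d) (η ψ : Hilb d) :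
    inner ℂ ψ (tfShift z η) * Complex.exp (-2 * Real.pi * (symp w z : ℝ) * Complex.I)
      = inner ℂ (weyl w ψ) (tfShift z (weyl w η)) := by
  rw [tfShift_weyl, inner_smul_right, inner_weyl_weyl, mul_comm]

/-- π(z) equals π(y)π(z - y) up to a unimodular scalar, which cancels between the two slots.
Dependence on z - y alone is what produces a convolution of functions. -/
theorem inner_tfShift_shift (A : Op d) (y z : Phase d) (ξ η : Hilb d) :
    inner ℂ (tfShift z η) (shift y A (tfShift z ξ))
      = (inner ℂ (tfShift (z - y) η) (A (tfShift (z - y) ξ)) : ℂ) := by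
  have h : ∀ ζ : Hilb d, tfShift z ζ
      = character (z - y).2 y.1 • tfShift y (tfShift (z - y) ζ) := by
    intro ζ
    rw [tfShift_tfShift, add_sub_cancel, smul_smul, ← character_add_right, add_neg_cancel]
    simp [character]
  rw [h, h, shift, map_smul, inner_smul_left, inner_smul_right, ← mul_assoc, Complex.conj_mul',
    norm_character, comp_apply, comp_apply, adjoint_tfShift_apply, inner_tfShift_tfShift]
  simp

theorem tr_comp_shift_rankOne (A : Op d) (z : Phase d) (ξ η : Hilb d) :
    tr (A.comp (shift z (InnerProductSpace.rankOne ℂ ξ η)))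
      = inner ℂ (tfShift z η) (A (tfShift z ξ)) := by
  have : shift z (InnerProductSpace.rankOne ℂ ξ η)
      = InnerProductSpace.rankOne ℂ (tfShift z ξ) (tfShift z η) := by
    ext1 ψ
    simp [shift, adjoint_inner_right]
  rw [this, tr_comp_rankOne]

end Shifts

/-- Tonelli applied to the series of norms. Countability of `ι` makes the limit over finite sets a
measurable one. -/
theorem integrable_of_hasSum {α ι G : Type*} {mα : MeasurableSpace α} {μ : Measure α}
    [NormedAddCommGroup G] [Countable ι] {F : ι → α → G} {g : α → G}
    (hF : ∀ i, Integrable (F i) μ) (hF' : Summable fun i => ∫ a, ‖F i a‖ ∂μ)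
    (hg : ∀ a, HasSum (fun i => F i a) (g a)) : Integrable g μ := by
  refine ⟨aestronglyMeasurable_of_tendsto_ae Filter.atTop
    (fun s : Finset ι => Finset.aestronglyMeasurable_fun_sum s fun i _ => (hF i).1)
    (Filter.Eventually.of_forall hg), ?_⟩
  have hle : ∀ a, ‖g a‖ₑ ≤ ∑' i, ‖F i a‖ₑ := fun a => by
    rw [← (hg a).tsum_eq]
    exact enorm_tsum_le_tsum_enorm
  refine (lintegral_mono hle).trans_lt ?_
  rw [lintegral_tsum fun i => (hF i).1.enorm]
  simp_rw [← ofReal_integral_norm_eq_lintegral_enorm (hF _)]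
  exact hF'.tsum_ofReal_lt_top

/-! ### Convolution of two operators and its symplectic Fourier transform -/

section OperatorConvolution

open ContinuousLinearMap

variable {d : ℕ} {ι κ : Type*} {S T : Op d} {u v : ι → Hilb d} {p q : κ → Hilb d}

theorem IsNuclearRep.shift (h : IsNuclearRep T p q) (z : Phase d) :
    IsNuclearRep (shift z T) (fun j => tfShift z (p j)) (fun j => tfShift z (q j)) := by
  simpa [PhaseSpace.shift] using
    (h.comp_right (ContinuousLinearMap.adjoint (tfShift z))).comp_left (tfShift z)

/-- The trace of `S α_z(T)`, expanded in rank one operators. -/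
theorem hasSum_tr_comp_shift (hS : IsNuclearRep S u v) (hT : IsNuclearRep T p q) (z : Phase d) :
    HasSum (fun k : ι × κ => (starRingEnd ℂ) (stft (p k.2) (v k.1) z) * stft (q k.2) (u k.1) z)
      (tr (S.comp (PhaseSpace.shift z T))) := by
  have hs : Summable (fun k : ι × κ =>
      (starRingEnd ℂ) (stft (p k.2) (v k.1) z) * stft (q k.2) (u k.1) z) := by
    refine Summable.of_norm_bounded (hS.summable.mul_of_nonneg hT.summable
      (fun _ => by positivity) (fun _ => by positivity)) fun k => ?_
    rw [norm_mul, RCLike.norm_conj]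
    calc _ ≤ (‖tfShift z (p k.2)‖ * ‖v k.1‖) * (‖tfShift z (q k.2)‖ * ‖u k.1‖) :=
          mul_le_mul (norm_inner_le_norm _ _) (norm_inner_le_norm _ _) (norm_nonneg _)
            (by positivity)
      _ = _ := by rw [norm_tfShift, norm_tfShift]; ring
  convert hs.hasSum using 1
  -- The index of `T` goes outside: the trace is expanded along `T`, then `S` inside each
  -- coefficient.
  refine Eq.trans ?_ ((Equiv.prodComm κ ι).tsum_eq _)
  refine Eq.trans ?_ (Summable.tsum_prod hs.prod_symm).symm
  rw [← ((hT.shift z).hasSum_tr_comp_left S).tsum_eq]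
  refine tsum_congr fun j => ?_
  have := (hS.hasSum (tfShift z (p j))).mapL (innerSL ℂ (tfShift z (q j)))
  rw [← innerSL_apply_apply ℂ, ← this.tsum_eq]
  refine tsum_congr fun i => ?_
  rw [map_smul, innerSL_apply_apply, smul_eq_mul, stft, stft, inner_conj_symm]
  rfl

theorem summable_integral_norm_stft (hS : IsNuclearRep S u v) (hT : IsNuclearRep T p q) :
    Summable fun k : ι × κ => ∫ z,
      ‖(starRingEnd ℂ) (stft (p k.2) (v k.1) z) * stft (q k.2) (u k.1) z‖ := by
  refine (hS.summable.mul_of_nonneg hT.summable (fun _ => by positivity)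
    (fun _ => by positivity)).of_nonneg_of_le
    (fun k => integral_nonneg fun z => norm_nonneg _) fun k => ?_
  refine (integral_norm_mul_stft_le _ _ _ _).trans (le_of_eq ?_)
  ring

/-- The character is absorbed by the conjugated factor alone, leaving a product to which Moyal's
identity applies. -/
theorem stft_mul_stft_mul_exp (w z : Phase d) (a b a' b' : Hilb d) :
    (starRingEnd ℂ) (stft a b z) * stft a' b' z
        * Complex.exp (-2 * Real.pi * (symp w z : ℝ) * Complex.I)
      = (starRingEnd ℂ) (stft (weyl w a) (weyl w b) z) * stft a' b' z := by
  rw [mul_right_comm, stft, stft, inner_conj_symm, stft_mul_exp, stft, inner_conj_symm]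

theorem norm_exp_symp (w z : Phase d) :
    ‖Complex.exp (-2 * Real.pi * (symp w z : ℝ) * Complex.I)‖ = 1 := by
  have h : (-2 * Real.pi * (symp w z : ℝ) * Complex.I : ℂ)
    = ((-2 * Real.pi * symp w z : ℝ) : ℂ) * Complex.I := by push_cast; ring
  rw [h, Complex.norm_exp_ofReal_mul_I]

variable [Countable ι] [Countable κ]

theorem integrable_tr_comp_shift (hS : IsNuclearRep S u v) (hT : IsNuclearRep T p q) :
    Integrable fun z => tr (S.comp (PhaseSpace.shift z T)) :=
  integrable_of_hasSum (fun _ => integrable_conj_mul_stft _ _ _ _)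
    (summable_integral_norm_stft hS hT) (hasSum_tr_comp_shift hS hT)

/-- Once the character is absorbed, Moyal evaluates each term as a coefficient from `S` times one
from `T`, so the double series factors into two traces. -/
theorem sympFourier_tr_comp_shift (hS : IsNuclearRep S u v) (hT : IsNuclearRep T p q)
    (w : Phase d) :
    sympFourier (fun z => tr (S.comp (PhaseSpace.shift z T))) w
      = tr ((weyl w).comp T) * fourierWigner S w := by
  set F : ι × κ → Phase d → ℂ := fun k z =>
    (starRingEnd ℂ) (stft (p k.2) (v k.1) z) * stft (q k.2) (u k.1) z
        * Complex.exp (-2 * Real.pi * (symp w z : ℝ) * Complex.I) with hF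
  have hFi : ∀ k, Integrable (F k) := fun k => by
    simp_rw [hF, stft_mul_stft_mul_exp]
    exact integrable_conj_mul_stft _ _ _ _
  have hFn : Summable fun k => ∫ z, ‖F k z‖ :=
    (summable_integral_norm_stft hS hT).congr fun k =>
      integral_congr_ae (Filter.Eventually.of_forall fun z => by
        simp only [hF, norm_mul, norm_exp_symp, mul_one])
  have hFs : ∀ k, ∫ z, F k z
      = inner ℂ (v k.1) (adjoint (weyl w) (u k.1)) * inner ℂ (q k.2) (weyl w (p k.2)) := fun k => by
    simp_rw [hF, stft_mul_stft_mul_exp]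
    rw [integral_conj_mul_stft, adjoint_inner_right]
  have h1 := hasSum_integral_of_summable_integral_norm hFi hFn
  have h0 : sympFourier (fun z => tr (S.comp (PhaseSpace.shift z T))) w = ∫ z, ∑' k, F k z := by
    refine integral_congr_ae (Filter.Eventually.of_forall fun z => ?_)
    exact (((hasSum_tr_comp_shift hS hT z).mul_right _).tsum_eq).symm
  have h3 := hS.hasSum_tr_comp_left (adjoint (weyl w))
  have h4 := hT.hasSum_tr_comp_left (weyl w)
  rw [funext hFs] at h1
  rw [h0, fourierWigner_eq, mul_comm]
  have h5 := h3.mul h4 h1.summable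
  rw [← h1.tsum_eq, ← h5.tsum_eq]

end OperatorConvolution

/-! ### The symplectic Fourier transform on L¹ -/

section SymplecticFourier

variable {d : ℕ} {f g : Phase d → ℂ}

theorem continuous_symp : Continuous fun p : Phase d × Phase d => symp p.1 p.2 := by
  unfold symp
  fun_prop

theorem integrable_mul_exp_symp (hf : Integrable f) (z : Phase d) :
    Integrable fun z' => f z' * Complex.exp (-2 * Real.pi * (symp z z' : ℝ) * Complex.I) := by
  refine hf.mul_bdd (c := 1) (Continuous.aestronglyMeasurable ?_)
    (Filter.Eventually.of_forall fun z' => (norm_exp_symp z z').le)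
  have := continuous_symp.comp (Continuous.prodMk_right z)
  simp only [Function.comp_def] at this
  fun_prop

theorem sympFourier_congr_ae (h : f =ᵐ[volume] g) : sympFourier f = sympFourier g := by
  ext z
  refine integral_congr_ae ?_
  filter_upwards [h] with z' hz'
  rw [hz']

theorem continuous_sympFourier (hf : Integrable f) : Continuous (sympFourier f) := by
  refine continuous_of_dominated (bound := fun z => ‖f z‖)
    (fun z => (integrable_mul_exp_symp hf z).1) (fun z => ?_) hf.norm ?_
  · filter_upwards with z'
    rw [norm_mul, norm_exp_symp, mul_one]
  · filter_upwards with z'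
    have := continuous_symp.comp (Continuous.prodMk_left z')
    simp only [Function.comp_def] at this
    fun_prop

/-- The symplectic Fourier transform is injective on integrable functions. -/
theorem ae_eq_of_sympFourier_eq (hf : Integrable f) (hg : Integrable g)
    (h : sympFourier f = sympFourier g) : f =ᵐ[volume] g := by
  have hfg : (f - g) =ᵐ[volume] 0 := by
    refine ae_eq_zero_of_integral_char_eq_zero (hf.sub hg) fun L => ?_
    let a := (InnerProductSpace.toDual ℝ (Conf d)).symm
      (L.comp (ContinuousLinearMap.inl ℝ (Conf d) (Conf d)))
    let b := (InnerProductSpace.toDual ℝ (Conf d)).symm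
      (L.comp (ContinuousLinearMap.inr ℝ (Conf d) (Conf d)))
    -- By Riesz, L v = a·v₁ + b·v₂; the point (b, -a)/2π undoes the swap and sign of the symplectic
    -- form and the factor -2π.
    have hL : ∀ v : Phase d, L v = -2 * Real.pi *
        symp (((2 * Real.pi)⁻¹ • b, -((2 * Real.pi)⁻¹ • a)) : Phase d) v := by
      intro v
      have h1 : inner ℝ a v.1 = L (v.1, 0) := InnerProductSpace.toDual_symm_apply
      have h2 : inner ℝ b v.2 = L (0, v.2) := InnerProductSpace.toDual_symm_apply
      have h3 : L v = L (v.1, 0) + L (0, v.2) := by rw [← map_add]; simp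
      rw [h3, symp, inner_neg_left, real_inner_smul_left, real_inner_smul_right,
        real_inner_comm b v.2, h1, h2]
      field_simp
      ring
    have h0 := congrFun h (((2 * Real.pi)⁻¹ • b, -((2 * Real.pi)⁻¹ • a)) : Phase d)
    rw [sympFourier, sympFourier, ← sub_eq_zero, ← integral_sub (integrable_mul_exp_symp hf _)
      (integrable_mul_exp_symp hg _)] at h0
    rw [← h0]
    refine integral_congr_ae (Filter.Eventually.of_forall fun v => ?_)
    simp only [Pi.sub_apply, ← sub_mul, hL]
    push_cast
    ring_nf
  filter_upwards [hfg] with z hz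
  exact sub_eq_zero.1 hz

instance isAddRightInvariant_volume : (volume : Measure (Phase d)).IsAddRightInvariant :=
  inferInstanceAs ((volume : Measure (Conf d)).prod volume).IsAddRightInvariant

theorem integrable_funConv (hf : Integrable f) (hg : Integrable g) : Integrable (funConv f g) :=
  hf.integrable_convolution _ hg

/-- The character is multiplicative, so it distributes over the two factors, and the integral of a
convolution is the product of the integrals. -/
theorem sympFourier_funConv (hf : Integrable f) (hg : Integrable g) (z : Phase d) :
    sympFourier (funConv f g) z = sympFourier f z * sympFourier g z := by
  have h := integral_convolution (ContinuousLinearMap.mul ℂ ℂ) (integrable_mul_exp_symp hf z)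
    (integrable_mul_exp_symp hg z)
  rw [ContinuousLinearMap.mul_apply'] at h
  refine Eq.trans (integral_congr_ae (Filter.Eventually.of_forall fun z' => ?_)) h
  simp only [funConv, convolution_def, ContinuousLinearMap.mul_apply', ← integral_mul_const]
  refine integral_congr_ae (Filter.Eventually.of_forall fun y => ?_)
  have he : Complex.exp (-2 * Real.pi * (symp z z' : ℝ) * Complex.I)
      = Complex.exp (-2 * Real.pi * (symp z y : ℝ) * Complex.I)
        * Complex.exp (-2 * Real.pi * (symp z (z' - y) : ℝ) * Complex.I) := by
    rw [← Complex.exp_add]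
    congr 1
    simp only [symp, Prod.fst_sub, Prod.snd_sub, inner_sub_left, inner_sub_right]
    push_cast
    ring
  simp only [he]
  ring

end SymplecticFourier

/-! ### Associativity, existence and uniqueness of the representations -/

section Representations

open ContinuousLinearMap

variable {d : ℕ} {f g : Phase d → ℂ} {σ S : Op d}

/-- Associativity of the convolutions: `(f ∗ A) ∗ Ť = f ∗ (A ∗ Ť)`. -/
theorem funConv_tr_comp_shift {κ : Type*} [Countable κ] {T : Op d} {p q : κ → Hilb d}
    (hf : Integrable f) (A : Op d) (hT : IsNuclearRep T p q) :
    funConv f (fun z => tr (A.comp (shift z T))) = fun z => tr ((funOpConv f A).comp (shift z T)) := by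
  ext z
  have hnorm : ∀ j y, ‖(inner ℂ (tfShift z (q j)) (shift y A (tfShift z (p j))) : ℂ)‖
      ≤ ‖A‖ * ‖p j‖ * ‖q j‖ := fun j y => by
    refine (norm_inner_shift_le _ _ _ _).trans_eq ?_
    rw [norm_tfShift, norm_tfShift]
  -- Sum and integral are exchanged under the bound ‖f‖₁‖A‖‖pⱼ‖‖qⱼ‖; boundedness of `A` suffices,
  -- and only `T` has to be nuclear.
  have h1 := hasSum_integral_of_summable_integral_norm
    (F := fun j y => f y * inner ℂ (tfShift z (q j)) (shift y A (tfShift z (p j))))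
    (fun j => integrable_mul_inner_shift hf A _ _) (by
      refine (hT.summable.mul_left ((∫ y, ‖f y‖) * ‖A‖)).of_nonneg_of_le
        (fun j => integral_nonneg fun y => norm_nonneg _) fun j => ?_
      calc _ ≤ ∫ y, ‖f y‖ * (‖A‖ * ‖p j‖ * ‖q j‖) := by
            refine integral_mono (integrable_mul_inner_shift hf A _ _).norm
              (hf.norm.mul_const _) fun y => ?_
            simp only [norm_mul]
            exact mul_le_mul_of_nonneg_left (hnorm j y) (norm_nonneg _)
        _ = _ := by rw [integral_mul_const]; ring)
  have h2 := (hT.shift z).hasSum_tr_comp_left (funOpConv f A)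
  simp_rw [inner_funOpConv hf] at h2
  rw [h2.unique h1, funConv, convolution_def]
  refine integral_congr_ae (Filter.Eventually.of_forall fun y => ?_)
  simp only [mul_apply', inner_tfShift_shift, tsum_mul_left]
  rw [((hT.shift (z - y)).hasSum_tr_comp_left A).tsum_eq]

theorem isGenHusimi_iff (hσ : IsTraceClass σ) (hS : IsTraceClass S) :
    IsGenHusimi σ S g ↔ g =ᵐ[volume] opConv S (check σ) := by
  obtain ⟨ι, u, v, hS⟩ := hS.exists_isNuclearRep
  obtain ⟨κ, p, q, hσ⟩ := hσ.exists_isNuclearRep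
  have hi := integrable_tr_comp_shift hS hσ
  rw [funext (opConv_check S σ)]
  constructor
  · rintro ⟨hg, h⟩
    exact ae_eq_of_sympFourier_eq hg hi
      (funext fun z => (h z).trans (sympFourier_tr_comp_shift hS hσ z).symm)
  · intro h
    refine ⟨hi.congr h.symm, fun z => ?_⟩
    rw [sympFourier_congr_ae h, sympFourier_tr_comp_shift hS hσ]

/-- Continuity in `z` upgrades almost everywhere to everywhere, and z = 0 recovers the matrix
coefficients of the operators. -/
theorem ext_of_inner_tfShift_ae_eq {A B : Op d}
    (h : ∀ ξ η : Hilb d, (fun z : Phase d => (inner ℂ (tfShift z η) (A (tfShift z ξ)) : ℂ))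
      =ᵐ[volume] fun z => inner ℂ (tfShift z η) (B (tfShift z ξ))) : A = B := by
  have hc : ∀ (A : Op d) (ξ η : Hilb d),
      Continuous fun z : Phase d => (inner ℂ (tfShift z η) (A (tfShift z ξ)) : ℂ) := fun A ξ η =>
    (continuous_tfShift η).inner (A.continuous.comp (continuous_tfShift ξ))
  ext1 ξ
  refine ext_inner_left ℂ fun η => ?_
  have := congrFun (((hc A ξ η).ae_eq_iff_eq volume (hc B ξ η)).1 (h ξ η)) 0
  simpa only [tfShift_zero] using this

theorem gaussian_coe (d : ℕ) : gaussian d =ᵐ[volume] gaussianFun d :=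
  (memLp_gaussianFun d).coeFn_toLp

theorem norm_gaussian (d : ℕ) : ‖gaussian d‖ = 1 := by
  have h : ∫ x : Conf d, ‖gaussianFun d x‖ ^ 2 = 1 := by
    have h1 : ∀ x : Conf d, ‖gaussianFun d x‖ ^ 2
        = 2 ^ ((d : ℝ) / 2) * Real.exp (-(2 * Real.pi) * ‖x‖ ^ 2) := by
      intro x
      rw [gaussianFun, Complex.norm_real, Real.norm_eq_abs, sq_abs, mul_pow, ← Real.exp_nat_mul,
        ← Real.rpow_natCast, ← Real.rpow_mul zero_le_two, real_inner_self_eq_norm_sq]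
      push_cast
      ring_nf
    simp_rw [h1]
    rw [integral_const_mul, GaussianFourier.integral_rexp_neg_mul_sq_norm (by positivity),
      finrank_euclideanSpace_fin, ← Real.mul_rpow (by norm_num) (by positivity)]
    have : 2 * (Real.pi / (2 * Real.pi)) = 1 := by field_simp
    rw [this, Real.one_rpow]
  have h2 : (inner ℂ (gaussian d) (gaussian d) : ℂ)
      = ((∫ x : Conf d, ‖gaussianFun d x‖ ^ 2 : ℝ) : ℂ) := by
    rw [L2.inner_def, ← integral_complex_ofReal]
    refine integral_congr_ae ?_
    filter_upwards [gaussian_coe d] with x hx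
    rw [hx, RCLike.inner_apply', Complex.conj_mul', Complex.ofReal_pow]
  rw [h, inner_self_eq_norm_sq_to_K] at h2
  have h3 : ‖gaussian d‖ ^ 2 = 1 := Complex.ofReal_injective (by simpa using h2)
  exact (pow_eq_one_iff_of_nonneg (norm_nonneg _) two_ne_zero).1 h3

theorem isTraceClass_gaussianProj (d : ℕ) : IsTraceClass (gaussianProj d) :=
  isTraceClass_rankOne_self (norm_gaussian d)

/-- A trace class operator `S` is `f ∗ σ^*` if and only if the Fourier transforms match. -/
theorem isGenGlauberSudarshan_iff (hσ : IsTraceClass σ) (hS : IsTraceClass S)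
    (hf : Integrable f) :
    IsGenGlauberSudarshan σ S f ↔ S = funOpConv f (adjoint σ) := by
  obtain ⟨ι, u, v, hS⟩ := hS.exists_isNuclearRep
  obtain ⟨κ, p, q, hσ⟩ := hσ.exists_isNuclearRep
  have hT := fun ξ η : Hilb d => isNuclearRep_rankOne ξ η
  have hi := fun ξ η => integrable_tr_comp_shift hσ.adjoint (hT ξ η)
  have hW : ∀ (ξ η : Hilb d) (z : Phase d),
      tr ((weyl z).comp (InnerProductSpace.rankOne ℂ ξ η)) = inner ℂ η (weyl z ξ) :=
    fun ξ η z => tr_comp_rankOne _ ξ η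
  -- Testing with rank-one operators avoids any need for `f ∗ σ^*` to be trace class.
  have hF : ∀ ξ η z, sympFourier
      (fun z => tr ((funOpConv f (adjoint σ)).comp (shift z (InnerProductSpace.rankOne ℂ ξ η)))) z
      = inner ℂ η (weyl z ξ)
        * (sympFourier f z * tr ((adjoint (weyl z)).comp (adjoint σ))) := fun ξ η z => by
    rw [← funConv_tr_comp_shift hf _ (hT ξ η), sympFourier_funConv hf (hi ξ η),
      sympFourier_tr_comp_shift hσ.adjoint (hT ξ η), hW, fourierWigner_eq]
    ring
  constructor
  · rintro ⟨-, h⟩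
    refine ext_of_inner_tfShift_ae_eq fun ξ η => ?_
    simp_rw [← tr_comp_shift_rankOne]
    refine ae_eq_of_sympFourier_eq (integrable_tr_comp_shift hS (hT ξ η)) ?_ (funext fun z => ?_)
    · rw [← funConv_tr_comp_shift hf _ (hT ξ η)]
      exact integrable_funConv hf (hi ξ η)
    · rw [sympFourier_tr_comp_shift hS (hT ξ η), hF, h, hW]
  · intro h
    refine ⟨hf, fun z => ?_⟩
    -- With ξ = φ and η = W(z)φ the common factor ⟨W(z)ξ, η⟩ is ‖φ‖² = 1 and cancels.
    have h1 := hF (gaussian d) (weyl z (gaussian d)) z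
    rw [← h, sympFourier_tr_comp_shift hS (hT _ _), hW] at h1
    refine (mul_left_cancel₀ ?_ h1).symm
    rw [inner_weyl_weyl, inner_self_ne_zero, ← norm_ne_zero_iff, norm_gaussian]
    exact one_ne_zero

/-- It shows that the denominator vanishes exactly on the reflection of the zero set of F_W(σ), so
density of the nonvanishing set carries over. -/
theorem tr_adjoint_weyl_comp_adjoint (hσ : IsTraceClass σ) (z : Phase d) :
    tr ((adjoint (weyl z)).comp (adjoint σ)) = (starRingEnd ℂ) (fourierWigner σ (-z)) := by
  obtain ⟨κ, p, q, hσ⟩ := hσ.exists_isNuclearRep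
  rw [fourierWigner_eq, adjoint_weyl, ← hσ.tr_comp_comm, ← tr_adjoint, adjoint_comp, adjoint_adjoint]

/-- Off the zeros of the denominator the transform is forced; continuity extends the equality from
that dense set. -/
theorem IsGenGlauberSudarshan.ae_eq (hσ : IsTraceClass σ)
    (hd : Dense {z | fourierWigner σ z ≠ 0}) (hf : IsGenGlauberSudarshan σ S f)
    (hg : IsGenGlauberSudarshan σ S g) : g =ᵐ[volume] f := by
  refine ae_eq_of_sympFourier_eq hg.1 hf.1 ?_
  refine Continuous.ext_on (hd.preimage (isOpenMap_neg (Phase d))) (continuous_sympFourier hg.1)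
    (continuous_sympFourier hf.1) fun z hz => ?_
  refine mul_right_cancel₀ ?_ ((hg.2 z).trans (hf.2 z).symm)
  rw [tr_adjoint_weyl_comp_adjoint hσ]
  simpa using hz

theorem isGenGlauberSudarshan_congr_ae (h : g =ᵐ[volume] f) (hf : IsGenGlauberSudarshan σ S f) :
    IsGenGlauberSudarshan σ S g :=
  ⟨hf.1.congr h.symm, fun z => by rw [sympFourier_congr_ae h, hf.2]⟩

end Representations

/-! ### The Gaussian window -/

section Gaussian

open ContinuousLinearMap

variable {d : ℕ} {f : Phase d → ℂ}

theorem opConv_check_gaussianProj (S : Op d) : opConv S (check (gaussianProj d)) = husimi S := by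
  ext z
  rw [opConv_check, gaussianProj, tr_comp_shift_rankOne, husimi]

theorem adjoint_gaussianProj (d : ℕ) : adjoint (gaussianProj d) = gaussianProj d := by
  refine ContinuousLinearMap.ext fun ψ => ext_inner_left ℂ fun η => ?_
  rw [adjoint_inner_right]
  simp [gaussianProj, inner_smul_left, inner_smul_right, mul_comm]

theorem shift_gaussianProj_apply (z : Phase d) (ψ : Hilb d) :
    shift z (gaussianProj d) ψ = stft (gaussian d) ψ z • tfShift z (gaussian d) := by
  simp [shift, gaussianProj, adjoint_inner_right, stft]

theorem integrable_stft_smul (hf : Integrable f) (ψ : Hilb d) :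
    Integrable fun z => (f z * stft (gaussian d) ψ z) • tfShift z (gaussian d) := by
  have hi : Integrable fun z => f z * stft (gaussian d) ψ z :=
    hf.mul_bdd (c := ‖gaussian d‖ * ‖ψ‖) (continuous_stft _ ψ).aestronglyMeasurable
      (Filter.Eventually.of_forall fun z =>
        (norm_inner_le_norm _ _).trans_eq (by rw [norm_tfShift]))
  exact hi.smul_bdd ‖gaussian d‖ (continuous_tfShift _).aestronglyMeasurable
    (Filter.Eventually.of_forall fun z => (norm_tfShift z _).le)

/-- Integrability of `f` makes the right side a Bochner integral, so it can be paired with `η` under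
the integral sign and compared with the weak definition. -/
theorem funOpConv_gaussianProj_apply (hf : Integrable f) (ψ : Hilb d) :
    funOpConv f (gaussianProj d) ψ
      = ∫ z, (f z * stft (gaussian d) ψ z) • tfShift z (gaussian d) := by
  refine ext_inner_left ℂ fun η => ?_
  rw [inner_funOpConv hf, ← integral_inner (integrable_stft_smul hf ψ)]
  refine integral_congr_ae (Filter.Eventually.of_forall fun z => ?_)
  simp only [shift_gaussianProj_apply, inner_smul_right, mul_assoc]

theorem isGlauberSudarshan_iff (hf : Integrable f) (S : Op d) :
    IsGlauberSudarshan S f ↔ S = funOpConv f (gaussianProj d) := by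
  refine ⟨fun h => ContinuousLinearMap.ext fun ψ => ?_, fun h ψ => ⟨integrable_stft_smul hf ψ, ?_⟩⟩
  · rw [(h ψ).2, funOpConv_gaussianProj_apply hf]
  · rw [h, funOpConv_gaussianProj_apply hf]

/-- The parallelogram law in the exponent separates `s` from `x`. -/
theorem gaussianFun_add_mul_gaussianFun_sub (s x : Conf d) :
    gaussianFun d (s + x) * gaussianFun d (s - x)
      = gaussianFun d x ^ 2 * Complex.exp (-((2 * Real.pi : ℝ) : ℂ) * (‖s‖ : ℂ) ^ 2) := by
  have h : (Real.exp (-Real.pi * ‖s + x‖ ^ 2) * Real.exp (-Real.pi * ‖s - x‖ ^ 2) : ℝ)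
      = Real.exp (-Real.pi * ‖x‖ ^ 2) ^ 2 * Real.exp (-(2 * Real.pi) * ‖s‖ ^ 2) := by
    rw [← Real.exp_add, ← Real.exp_nat_mul, ← Real.exp_add, norm_add_sq_real, norm_sub_sq_real]
    congr 1
    push_cast
    ring
  have h' : Complex.exp (-((2 * Real.pi : ℝ) : ℂ) * (‖s‖ : ℂ) ^ 2)
      = (Real.exp (-(2 * Real.pi) * ‖s‖ ^ 2) : ℂ) := by
    push_cast
    rfl
  rw [h']
  simp only [gaussianFun, real_inner_self_eq_norm_sq]
  norm_cast
  rw [mul_mul_mul_comm, h]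
  ring

theorem inner_gaussian_tfShift_ne_zero (z : Phase d) :
    (inner ℂ (gaussian d) (tfShift z (gaussian d)) : ℂ) ≠ 0 := by
  have h0 : (inner ℂ (gaussian d) (tfShift z (gaussian d)) : ℂ)
      = ∫ t, gaussianFun d t * (character z.2 t * gaussianFun d (t - z.1)) := by
    rw [L2.inner_def]
    refine integral_congr_ae ?_
    filter_upwards [gaussian_coe d, tfShift_coe z (gaussian d),
      (measurePreserving_sub_right volume z.1).quasiMeasurePreserving.ae_eq_comp (gaussian_coe d)]
      with t h1 h2 h3
    have h3' : gaussian d (t - z.1) = gaussianFun d (t - z.1) := h3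
    rw [RCLike.inner_apply', h2, h1, h3', gaussianFun, Complex.conj_ofReal]
  -- Centring at half of z.1 puts the two Gaussians symmetrically, leaving a nonzero constant times
  -- a Gaussian with a linear exponent, whose integral is explicit.
  have h1 : ∀ s : Conf d, gaussianFun d (s + (2 : ℝ)⁻¹ • z.1) * (character z.2 (s + (2 : ℝ)⁻¹ • z.1)
        * gaussianFun d (s + (2 : ℝ)⁻¹ • z.1 - z.1))
      = gaussianFun d ((2 : ℝ)⁻¹ • z.1) ^ 2 * character z.2 ((2 : ℝ)⁻¹ • z.1) *
        Complex.exp (-((2 * Real.pi : ℝ) : ℂ) * (‖s‖ : ℂ) ^ 2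
          + (2 * Real.pi * Complex.I) * (inner ℝ z.2 s : ℝ)) := by
    intro s
    have hs : s + (2 : ℝ)⁻¹ • z.1 - z.1 = s - (2 : ℝ)⁻¹ • z.1 := by module
    rw [hs, mul_left_comm, gaussianFun_add_mul_gaussianFun_sub, character_add_right,
      Complex.exp_add, character, mul_right_comm (2 * Real.pi : ℂ) Complex.I]
    ring
  rw [h0, ← integral_add_right_eq_self _ ((2 : ℝ)⁻¹ • z.1)]
  simp_rw [h1]
  have hb : 0 < ((2 * Real.pi : ℝ) : ℂ).re := by simpa using Real.pi_pos
  rw [integral_const_mul, GaussianFourier.integral_cexp_neg_mul_sq_norm_add hb]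
  refine mul_ne_zero (mul_ne_zero (pow_ne_zero _ ?_) (Complex.exp_ne_zero _))
    (mul_ne_zero ?_ (Complex.exp_ne_zero _))
  · rw [gaussianFun, Complex.ofReal_ne_zero]
    positivity
  · refine (Complex.cpow_ne_zero_iff).2 (Or.inl (div_ne_zero ?_ ?_))
    · exact_mod_cast Real.pi_ne_zero
    · exact fun h => hb.ne' (by rw [h]; rfl)

theorem fourierWigner_gaussianProj_ne_zero (z : Phase d) :
    fourierWigner (gaussianProj d) z ≠ 0 := by
  rw [fourierWigner_eq, gaussianProj, tr_comp_rankOne, adjoint_weyl, weyl_apply, inner_smul_right]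
  refine mul_ne_zero ?_ (inner_gaussian_tfShift_ne_zero _)
  rw [← norm_ne_zero_iff, norm_halfPhase]
  exact one_ne_zero

end Gaussian

end

end PhaseSpace

/-! ### Assembly of the theorem -/

theorem theorem3p1 (d : ℕ) :
    (∀ σ S : Op d, IsTraceClass σ → IsTraceClass S →
      -- (1) the generalized Husimi representation is `S ∗ σ̌`
      (Integrable (opConv S (check σ)) ∧
        (∀ g : Phase d → ℂ, IsGenHusimi σ S g ↔ g =ᵐ[volume] opConv S (check σ)) ∧
        ∀ z, opConv S (check σ) z = tr (S.comp (shift z σ))) ∧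
      -- (2) if `S = f ∗ σ^*`, then the generalized Glauber-Sudarshan representation is `f`
      (∀ f : Phase d → ℂ, Integrable f →
        S = funOpConv f (ContinuousLinearMap.adjoint σ) →
          IsGenGlauberSudarshan σ S f ∧
          (Dense {z | fourierWigner σ z ≠ 0} →
            ∀ g : Phase d → ℂ, IsGenGlauberSudarshan σ S g ↔ g =ᵐ[volume] f)) ∧
      -- (3) the relation between the two representations
      (∀ f g : Phase d → ℂ, IsGenGlauberSudarshan σ S f → IsGenHusimi σ S g →
        S = funOpConv f (ContinuousLinearMap.adjoint σ) ∧
        g =ᵐ[volume] opConv (funOpConv f (ContinuousLinearMap.adjoint σ)) (check σ) ∧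
        opConv (funOpConv f (ContinuousLinearMap.adjoint σ)) (check σ)
          = funConv f (opConv (ContinuousLinearMap.adjoint σ) (check σ)) ∧
        funConv f (opConv (ContinuousLinearMap.adjoint σ) (check σ))
          = funConv f (fun z => tr ((ContinuousLinearMap.adjoint σ).comp (shift z σ))))) ∧
    -- the Gaussian case
    (∀ S : Op d, IsTraceClass S →
      opConv S (check (gaussianProj d)) = husimi S ∧
      (∀ g : Phase d → ℂ, IsGenHusimi (gaussianProj d) S g ↔ g =ᵐ[volume] husimi S) ∧
      (∀ f : Phase d → ℂ, Integrable f →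
        (IsGenGlauberSudarshan (gaussianProj d) S f ↔ IsGlauberSudarshan S f)) ∧
      (∀ f g : Phase d → ℂ, IsGenGlauberSudarshan (gaussianProj d) S f →
        IsGenGlauberSudarshan (gaussianProj d) S g → f =ᵐ[volume] g)) := by
  refine ⟨fun σ S hσ hS => ⟨⟨?_, fun g => isGenHusimi_iff hσ hS, opConv_check S σ⟩, ?_, ?_⟩,
    fun S hS => ⟨opConv_check_gaussianProj S, fun g => ?_, fun f hf => ?_, fun f g hf hg => ?_⟩⟩
  · exact ((isGenHusimi_iff hσ hS).2 (Filter.EventuallyEq.refl _ _)).1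
  · intro f hf hSf
    have h := (isGenGlauberSudarshan_iff hσ hS hf).2 hSf
    exact ⟨h, fun hd g => ⟨h.ae_eq hσ hd, fun hg => isGenGlauberSudarshan_congr_ae hg h⟩⟩
  · intro f g hf hg
    have h := (isGenGlauberSudarshan_iff hσ hS hf.1).1 hf
    obtain ⟨κ, p, q, hrep⟩ := hσ.exists_isNuclearRep
    refine ⟨h, h ▸ (isGenHusimi_iff hσ hS).1 hg, ?_, ?_⟩
    · rw [funext (opConv_check _ σ), funext (opConv_check _ σ), funConv_tr_comp_shift hf.1 _ hrep]
    · rw [funext (opConv_check _ σ)]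
  · rw [isGenHusimi_iff (isTraceClass_gaussianProj d) hS, opConv_check_gaussianProj]
  · rw [isGenGlauberSudarshan_iff (isTraceClass_gaussianProj d) hS hf, adjoint_gaussianProj,
      isGlauberSudarshan_iff hf]
  -- The nonvanishing set of F_W(φ ⊗ φ) is the whole phase space, hence dense.
  · refine hg.ae_eq (isTraceClass_gaussianProj d) ?_ hf
    simp [fourierWigner_gaussianProj_ne_zero]
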